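/- Let $H=(V,E)$ be a $4$-uniform hypergraph. For an unordered pair $uv$ of distinct vertices, the link $H_{uv}$ is the graph on $V$ with edge set $\{xy: \{u,v,x,y\}\in E\}$; for a vertex $v$, $\overline H_v$ is the $3$-uniform hypergraph on $V\setminus\{v\}$ with edge set $\{xyw: \{v,x,y,w\}\in E\}$; and $\delta_2(H)$ is the minimum, over all pairs of distinct vertices, of the number of edges containing the pair. A graph $R$ is $(\beta,\ell)$-robust if for any two distinct vertices $x,y$ of $R$ there are at least $\beta|V(R)|^{\ell-1}$ $x$-$y$-paths of length $\ell$ (that is, with $\ell$ edges) in $R$. Setup. Let $\alpha\in(0,1/3)$ and $\beta>0$, let $\ell\ge 3$ be an odd integer, put $\mu=\alpha^3/18$, and let $H=(V,E)$ be a $4$-uniform hypergraph with $|V|=n$ and $\delta_2(H)\ge(\frac59+\alpha)\frac{n^2}{2}$. For every unordered pair $uv$ of distinct vertices let a $(\beta,\ell)$-robust induced subgraph $R_{uv}\subseteq H_{uv}$ be fixed such that (i) $|V(R_{uv})|\ge(\frac23+\frac\alpha2)n$, (ii) at most $\mu n^2$ edges of $H_{uv}$ join $V(R_{uv})$ to $V\setminus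 V(R_{uv})$, and (iii) $e(R_{uv})\ge(\frac59+\frac\alpha2)\frac{n^2}{2}-\frac{(n-|V(R_{uv})|)^2}{2}$. Let $\zeta>0$. A pair $xy$ of distinct vertices of $\overline H_v$ is $\zeta$-connectable in $\overline H_v$ if $xy\in E(R_{uv})$ for at least $\zeta(n-1)$ vertices $u\in V\setminus\{v\}$. A triple $(x,y,z)$ is a $\zeta$-bridge in $\overline H_v$ if $xyz\in E(\overline H_v)$ and both $xy$ and $yz$ are $\zeta$-connectable in $\overline H_v$. A triple $(x,y,z)\in V^3$ is $\zeta$-connectable in $H$ if it is a $\zeta$-bridge in $\overline H_v$ for at least $\zeta n$ vertices $v\in V$. A tight $abc$-$xyz$-path with $m$ inner vertices is a sequence of $m+6$ distinct vertices that starts with $a,b,c$ and ends with $x,y,z$ and in which any four consecutive vertices form an edge of $H$. Proposition (Connecting lemma). For all $\alpha\in(0,1/3)$, $\beta>0$, odd $\ell\ge3$, and $\zeta>0$ there are $\theta=\theta(\alpha,\beta,\ell,\zeta)>0$ and $n_0=n_0(\alpha,\beta,\ell,\zeta)$ such that the following holds for every hypergraph $H$ and all subgraphs $R_{uv}$ as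 in the setup with $n\ge n_0$. If $(a,b,c)$ and $(x,y,z)$ are disjoint $\zeta$-connectable triples in $H$, then the number of tight $abc$-$xyz$-paths in $H$ with exactly $8\ell+10$ inner vertices is at least $\theta n^{8\ell+10}$. -/

import Mathlib

/-! ### Hypergraphs: degrees, links, tight paths -/

/-- Every edge has exactly `k` vertices. -/
def Hypergraph.IsUniform {V : Type*} (H : Hypergraph V) (k : ℕ) : Prop :=
  ∀ e ∈ H.edgeSet, e.encard = k

/-- The degree `d_H(S)`: the number of edges containing `S`. -/
noncomputable def Hypergraph.degree {V : Type*} (H : Hypergraph V) (S : Set V) : ℕ :=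
  {e | e ∈ H.edgeSet ∧ S ⊆ e}.ncard

/-- The minimum `j`-degree `δ_j(H)`: the minimum of `d_H(S)` over all `j`-element sets `S` of
vertices. -/
noncomputable def Hypergraph.minDegree {V : Type*} (H : Hypergraph V) (j : ℕ) : ℕ :=
  sInf {d | ∃ S : Set V, S ⊆ H.vertexSet ∧ S.encard = j ∧ d = H.degree S}

/-- The link `H_v` of a vertex `v`: it has the same vertex set as `H`, and its edges are the sets
`e` not containing `v` such that `e ∪ {v}` is an edge of `H`. -/
def Hypergraph.link {V : Type*} (H : Hypergraph V) (v : V) : Hypergraph V where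
  vertexSet := H.vertexSet
  edgeSet := {e | v ∉ e ∧ insert v e ∈ H.edgeSet}
  subset_vertexSet_of_mem_edgeSet' _ he :=
    (Set.subset_insert _ _).trans (H.subset_vertexSet_of_mem_edgeSet' he.2)

/-- The hypergraph `H - v` obtained from `H` by deleting the vertex `v`. -/
def Hypergraph.deleteVertex {V : Type*} (H : Hypergraph V) (v : V) : Hypergraph V where
  vertexSet := H.vertexSet \ {v}
  edgeSet := {e | e ∈ H.edgeSet ∧ v ∉ e}
  subset_vertexSet_of_mem_edgeSet' _ he _ hx :=
    ⟨H.subset_vertexSet_of_mem_edgeSet' he.1 hx, fun h => he.2 (h ▸ hx)⟩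

/-- The link `H_{uv}` of an unordered pair `uv` in a `4`-uniform hypergraph `H`: the graph in which
`x` and `y` are adjacent when `{u, v, x, y}` is an edge of `H`. -/
def Hypergraph.pairLink {V : Type*} (H : Hypergraph V) (uv : Sym2 V) : SimpleGraph V where
  Adj x y := x ≠ y ∧ (uv : Set V) ∪ {x, y} ∈ H.edgeSet
  symm := ⟨fun x y h => ⟨h.1.symm, Set.pair_comm x y ▸ h.2⟩⟩
  loopless := ⟨fun _ h => h.1 rfl⟩

/-- A tight path in a `4`-uniform hypergraph, given by the sequence `p` of its vertices: the
vertices are distinct, and any four consecutive ones form an edge. -/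
def Hypergraph.IsTightPath {V : Type*} (H : Hypergraph V) {N : ℕ} (p : Fin N → V) : Prop :=
  Function.Injective p ∧
    ∀ (i : ℕ) (hi : i + 3 < N),
      ({p ⟨i, by omega⟩, p ⟨i + 1, by omega⟩, p ⟨i + 2, by omega⟩, p ⟨i + 3, hi⟩} : Set V)
        ∈ H.edgeSet

/-- The set of tight `abc`-`xyz`-paths with exactly `m` inner vertices in a `4`-uniform
hypergraph. -/
def Hypergraph.tightPaths {V : Type*} (H : Hypergraph V) (m : ℕ) (a b c x y z : V) :
    Set (Fin (m + 6) → V) :=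
  {p | H.IsTightPath p ∧
    p ⟨0, by omega⟩ = a ∧ p ⟨1, by omega⟩ = b ∧ p ⟨2, by omega⟩ = c ∧
    p ⟨m + 3, by omega⟩ = x ∧ p ⟨m + 4, by omega⟩ = y ∧ p ⟨m + 5, by omega⟩ = z}

/-! ### Robust graphs -/

/-- A graph `R` is `(β, ℓ)`-robust if for any two distinct vertices `x`, `y` there are at least
`β |V(R)|^(ℓ-1)` paths of length `ℓ` from `x` to `y`. -/
def SimpleGraph.IsRobust {W : Type*} (R : SimpleGraph W) (β : ℝ) (ℓ : ℕ) : Prop :=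
  ∀ x y : W, x ≠ y →
    β * (Nat.card W : ℝ) ^ (ℓ - 1) ≤ ({p : R.Walk x y | p.IsPath ∧ p.length = ℓ}.ncard : ℝ)

/-- The number `e_G(A, B)` of edges of `G` between two disjoint vertex sets `A` and `B`. -/
noncomputable def SimpleGraph.edgesBetween {V : Type*} (G : SimpleGraph V) (A B : Set V) : ℕ :=
  {p : V × V | p.1 ∈ A ∧ p.2 ∈ B ∧ G.Adj p.1 p.2}.ncard

/-- `R` is a large, dense, `(β, ℓ)`-robust induced subgraph of the graph `G`, with few edges of `G`
leaving it. -/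
structure SimpleGraph.Subgraph.IsRobustPart {V : Type*} {G : SimpleGraph V} (R : G.Subgraph)
    (α μ β : ℝ) (ℓ : ℕ) : Prop where
  induced : R.IsInduced
  robust : R.coe.IsRobust β ℓ
  card_verts : (2 / 3 + α / 2) * (Nat.card V : ℝ) ≤ (R.verts.ncard : ℝ)
  card_cut : (G.edgesBetween R.verts R.vertsᶜ : ℝ) ≤ μ * (Nat.card V : ℝ) ^ 2
  card_edges : (5 / 9 + α / 2) * (Nat.card V : ℝ) ^ 2 / 2
      - ((Nat.card V : ℝ) - (R.verts.ncard : ℝ)) ^ 2 / 2 ≤ (R.edgeSet.ncard : ℝ)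

/-! ### Connectable pairs, bridges, and connectable triples -/

/-- Let `H` be a `3`-uniform hypergraph, and for every vertex `v` let a graph `R v` be given (only
its edges matter here). The pair `xy` of distinct vertices of `H` is `ζ`-connectable if there are
at least `ζ |V(H)|` vertices `v` of `H` such that `xy` is an edge of `R v`. -/
def Hypergraph.IsConnectablePair {V : Type*} (H : Hypergraph V) (R : V → SimpleGraph V) (ζ : ℝ)
    (x y : V) : Prop :=
  x ∈ H.vertexSet ∧ y ∈ H.vertexSet ∧ x ≠ y ∧
    ζ * (H.vertexSet.ncard : ℝ) ≤ ({v | v ∈ H.vertexSet ∧ (R v).Adj x y}.ncard : ℝ)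

/-- The triple `(x, y, z)` is a `ζ`-bridge in the `3`-uniform hypergraph `H` if `xyz` is an edge
and both `xy` and `yz` are `ζ`-connectable. -/
def Hypergraph.IsBridge {V : Type*} (H : Hypergraph V) (R : V → SimpleGraph V) (ζ : ℝ)
    (x y z : V) : Prop :=
  ({x, y, z} : Set V) ∈ H.edgeSet ∧ H.IsConnectablePair R ζ x y ∧ H.IsConnectablePair R ζ y z

/-- Let `H` be a `4`-uniform hypergraph, and for every pair `uv` of vertices let a subgraph `R_{uv}`
of the link `H_{uv}` be given. The triple `(x, y, z)` is `ζ`-connectable in `H` if there are at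
least `ζ |V(H)|` vertices `v` of `H` such that `(x, y, z)` is a `ζ`-bridge in the `3`-uniform
hypergraph `H_v - v` with respect to the family of the graphs `R_{uv}`. -/
def Hypergraph.IsConnectableTriple {V : Type*} (H : Hypergraph V)
    (R : ∀ uv : Sym2 V, (H.pairLink uv).Subgraph) (ζ : ℝ) (x y z : V) : Prop :=
  ζ * (H.vertexSet.ncard : ℝ) ≤
    ({v | v ∈ H.vertexSet ∧
      ((H.link v).deleteVertex v).IsBridge (fun u => (R s(u, v)).spanningCoe) ζ x y z}.ncard : ℝ)

/-! ### Counting lemmas -/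

/-! Write `ℓ = 2k + 1`. A path has `16k + 24` vertices and is made of two halves of `8k + 12`
vertices each, the second built backwards from `z`. Take `v` such that `abc` is a bridge in the link
of `v`, and `w` such that `xyz` is a bridge in the link of `w`. If `ss'`, `s'r'`, `r'r` are edges of
`R_{vw}`, then a half ending in `s, s', v` can be followed by the reverse of a half ending in `r,
r', w`: each window across the middle consists of `v`, `w` and one of these three edges. A half
itself is `a` followed by a tight walk from `bc` to `ss'` in the link of `v`, with `v` inserted
after every three vertices.

Tight walks in the link of `v` between connectable pairs `bc` and `de` arise in the same way one
uniformity lower. Choose `u`, `u'` with `bc ∈ R_{uv}` and `de ∈ R_{u'v}`. Robustness gives walks of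
length `ℓ` from `c` in `R_{uv}` and from `d` in `R_{u'v}` with prescribed ends, and the ends are
joined by a common edge of the two graphs (`le_card_common_pairs`). Then `u` and `u'` are inserted
after every two vertices.

So far the inserted vertex is always the same. Since the configurations (walks, inserted pair) have
positive density, the power-mean inequality gives a positive proportion of configurations in which
the inserted pairs are chosen independently (`Finset.le_card_blowup`). It is applied once in the
links and once in `H`.

It remains to find many `v`, `w` and walks `s s' r' r` in `R_{vw}` with `ss'` connectable for `v`
and `rr'` connectable for `w`, which is an averaging argument (`le_card_connecting_walks`). Walks
with repeated vertices number only `O(n^(16k + 17))` and are discarded at the end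
(`Hypergraph.le_ncard_tightPaths`). -/

open Finset in
/-- Double counting by fibres. -/
theorem Finset.card_mul_le_card_of_le_fiber {τ κ : Type*} [DecidableEq κ] (T : Finset τ) (K : Finset κ)
    (f : τ → κ) (m : ℝ) (h : ∀ k ∈ K, m ≤ #{t ∈ T | f t = k}) : (#K : ℝ) * m ≤ #T := by
  have h1 : #{t ∈ T | f t ∈ K} = ∑ k ∈ K, #{t ∈ {t ∈ T | f t ∈ K} | f t = k} :=
    card_eq_sum_card_fiberwise fun t ht => (mem_filter.1 ht).2
  have h2 : (#K : ℝ) * m ≤ ∑ k ∈ K, (#{t ∈ {t ∈ T | f t ∈ K} | f t = k} : ℝ) := by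
    rw [← nsmul_eq_mul]
    refine card_nsmul_le_sum _ _ _ fun k hk => (h k hk).trans ?_
    rw [filter_filter]
    exact_mod_cast card_le_card fun t ht => by
      simp only [mem_filter] at ht ⊢
      exact ⟨ht.1, ht.2 ▸ hk, ht.2⟩
  refine h2.trans ?_
  rw [← Nat.cast_sum, ← h1]
  exact_mod_cast card_filter_le _ _

open Finset Classical in
/-- A dense relation between `S` and `ω` has many `m`-fold blow-ups in its second coordinate. -/
theorem Finset.le_card_blowup {σ ω : Type*} [Fintype ω] (S : Finset σ) (r : σ → ω → Prop)
    {c s w : ℝ} (hc : 0 ≤ c) (hw : 0 ≤ w) (hs : 0 < s) (hS : (#S : ℝ) ≤ s)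
    (h : c * s * w ≤ #{x ∈ S ×ˢ (univ : Finset ω) | r x.1 x.2}) (m : ℕ) :
    c ^ (m + 1) * s * w ^ (m + 1) ≤
      #{x ∈ S ×ˢ (univ : Finset (Fin (m + 1) → ω)) | ∀ i, r x.1 (x.2 i)} := by
  set d : σ → ℝ := fun x => #{y : ω | r x y}
  have h1 : (#{x ∈ S ×ˢ (univ : Finset ω) | r x.1 x.2} : ℝ) = ∑ x ∈ S, d x := by
    simp only [d, card_filter, sum_product]
    push_cast
    rfl
  have h2 : (#{x ∈ S ×ˢ (univ : Finset (Fin (m + 1) → ω)) | ∀ i, r x.1 (x.2 i)} : ℝ) =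
      ∑ x ∈ S, d x ^ (m + 1) := by
    have key (x : σ) : d x ^ (m + 1) = (#{f : Fin (m + 1) → ω | ∀ i, r x (f i)} : ℝ) := by
      rw [← Nat.cast_pow, ← Fintype.card_piFinset_const]
      congr 2
      ext f
      simp
    simp only [key, card_filter, sum_product]
    push_cast
    rfl
  rw [h1] at h
  rw [h2]
  -- Each `x` has `d x ^ (m + 1)` blow-ups, so the power-mean inequality applies. Its lower bound
  -- decreases in `#S`, hence the upper bound `s` for `#S` is enough.
  have h3 := pow_sum_div_card_le_sum_pow (s := S) (f := d) (fun _ _ => Nat.cast_nonneg _) m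
  rcases S.eq_empty_or_nonempty with rfl | hne
  · have : c * s * w = 0 := le_antisymm (by simpa using h) (by positivity)
    have h0 : c * w = 0 := by
      rcases mul_eq_zero.1 this with h' | h'
      · rw [(mul_eq_zero.1 h').resolve_right hs.ne', zero_mul]
      · rw [h', mul_zero]
    have : c ^ (m + 1) * s * w ^ (m + 1) = (c * w) ^ (m + 1) * s := by ring
    simp [this, h0]
  · have hpos : (0 : ℝ) < #S := by exact_mod_cast hne.card_pos
    refine le_trans ?_ h3
    rw [le_div_iff₀ (by positivity)]
    calc c ^ (m + 1) * s * w ^ (m + 1) * (#S : ℝ) ^ m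
        ≤ c ^ (m + 1) * s * w ^ (m + 1) * s ^ m := by gcongr
      _ = (c * s * w) ^ (m + 1) := by ring
      _ ≤ _ := by gcongr

open Finset in
/-- Functions that are determined by their values on `F`. -/
theorem Finset.card_le_pow_of_determined {ι V : Type*} [Fintype V] (S : Finset (ι → V))
    (F : Finset ι) (h : ∀ p ∈ S, ∀ q ∈ S, (∀ i ∈ F, p i = q i) → p = q) :
    #S ≤ Fintype.card V ^ #F := by
  classical
  have := card_le_card_of_injOn (s := S) (t := (univ : Finset (F → V))) (fun p i => p i)
    (fun _ _ => mem_coe.2 (mem_univ _))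
    (fun p hp q hq hpq => h p hp q hq fun i hi => congrFun hpq ⟨i, hi⟩)
  simpa using this

open Finset Classical in
theorem card_filter_apply_zero_le {V : Type*} [Fintype V] (n : ℕ) (a : V) :
    #{p : Fin (n + 1) → V | p 0 = a} ≤ Fintype.card V ^ n := by
  have := card_le_pow_of_determined {p : Fin (n + 1) → V | p 0 = a} (univ.erase 0)
    fun p hp q hq hpq => funext fun i => by
      simp only [mem_filter, mem_univ, true_and, mem_erase, and_true] at hp hq hpq
      by_cases hi : i = 0
      · rw [hi, hp, hq]
      · exact hpq i hi
  simpa using this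

open Finset Classical in
theorem card_filter_apply_zero_one_le {V : Type*} [Fintype V] (n : ℕ) (a b : V) :
    #{p : Fin (n + 2) → V | p 0 = a ∧ p 1 = b} ≤ Fintype.card V ^ n := by
  have := card_le_pow_of_determined {p : Fin (n + 2) → V | p 0 = a ∧ p 1 = b}
    ((univ.erase 0).erase 1)
    fun p hp q hq hpq => funext fun i => by
      simp only [mem_filter, mem_univ, true_and, mem_erase, and_true] at hp hq hpq
      by_cases hi : i = 0
      · rw [hi, hp.1, hq.1]
      · by_cases hi' : i = 1
        · rw [hi', hp.2, hq.2]
        · exact hpq i ⟨hi', hi⟩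
  simpa using this

open Finset Classical in
/-- Few functions with prescribed distinct values on `E` fail to be injective. -/
theorem card_not_injective_le {ι V : Type*} [Fintype ι] [Fintype V] (E : Finset ι) (g : ι → V)
    (hg : Set.InjOn g E) (S : Finset (ι → V))
    (hS : ∀ p ∈ S, (∀ i ∈ E, p i = g i) ∧ ¬ Function.Injective p) :
    #S ≤ Fintype.card ι ^ 2 * Fintype.card V ^ (Fintype.card ι - #E - 1) := by
  rw [← card_compl]
  -- Two coinciding coordinates cannot both lie in `E`, as `g` is injective there. One of them is
  -- outside `E` and a copy of the other, so a degree of freedom is lost.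
  have hsub : S ⊆
      ({x : ι × ι | x.1 ≠ x.2 ∧ x.1 ∉ E} : Finset _).biUnion
        fun x => {p : ι → V | (∀ i ∈ E, p i = g i) ∧ p x.1 = p x.2} := by
    intro p hp
    obtain ⟨hE, hinj⟩ := hS p hp
    simp only [mem_filter, mem_univ, true_and, mem_biUnion, Prod.exists]
    simp only [Function.Injective, not_forall] at hinj
    obtain ⟨i, j, hij, hne⟩ := hinj
    by_cases hi : i ∈ E
    · by_cases hj : j ∈ E
      · exact absurd (hg hi hj (by rw [← hE i hi, ← hE j hj, hij])) hne
      · exact ⟨j, i, ⟨Ne.symm hne, hj⟩, hE, hij.symm⟩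
    · exact ⟨i, j, ⟨hne, hi⟩, hE, hij⟩
  refine (card_le_card hsub).trans ((card_biUnion_le_card_mul _ _
    (Fintype.card V ^ (#Eᶜ - 1)) ?_).trans ?_)
  · rintro ⟨i, j⟩ hx
    simp only [mem_filter, mem_univ, true_and] at hx
    rw [← card_erase_of_mem (mem_compl.2 hx.2)]
    refine card_le_pow_of_determined _ _ fun p hp q hq hpq => ?_
    simp only [mem_filter, mem_univ, true_and, mem_erase, mem_compl] at hp hq hpq
    have hoff : ∀ k, k ≠ i → p k = q k := fun k hk => by
      by_cases hkE : k ∈ E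
      · rw [hp.1 k hkE, hq.1 k hkE]
      · exact hpq k ⟨hk, hkE⟩
    funext k
    by_cases hk : k = i
    · rw [hk, hp.2, hq.2, hoff j hx.1.symm]
    · exact hoff k hk
  · refine Nat.mul_le_mul_right _ ?_
    rw [sq, ← Fintype.card_prod]
    exact card_le_univ _

/-! ### Interleaving sequences -/

/-- The sequence `a, p 0, p 1, …`, continued by `a`. -/
def extendCons {V : Type*} {n : ℕ} (a : V) (p : Fin n → V) : ℕ → V
  | 0 => a
  | i + 1 => if h : i < n then p ⟨i, h⟩ else a

theorem extendCons_succ {V : Type*} {n : ℕ} (a : V) (p : Fin n → V) {i : ℕ} (h : i < n) :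
    extendCons a p (i + 1) = p ⟨i, h⟩ := dif_pos h

/-- Insert the terms of `u` after every `d` terms of `p`. -/
def weave {V : Type*} (d : ℕ) (p u : ℕ → V) (j : ℕ) : V :=
  if j % (d + 1) = d then u (j / (d + 1)) else p (d * (j / (d + 1)) + j % (d + 1))

theorem weave_inserted {V : Type*} (d : ℕ) (p u : ℕ → V) (a : ℕ) :
    weave d p u ((d + 1) * a + d) = u a := by
  have h1 : ((d + 1) * a + d) % (d + 1) = d := by
    rw [Nat.mul_add_mod]; exact Nat.mod_eq_of_lt (Nat.lt_succ_self d)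
  have h2 : ((d + 1) * a + d) / (d + 1) = a := by
    rw [Nat.mul_add_div (Nat.succ_pos d), Nat.div_eq_of_lt (Nat.lt_succ_self d), add_zero]
  rw [weave, if_pos h1, h2]

theorem weave_original {V : Type*} (d : ℕ) (p u : ℕ → V) (a : ℕ) {r : ℕ} (hr : r < d) :
    weave d p u ((d + 1) * a + r) = p (d * a + r) := by
  have h1 : ((d + 1) * a + r) % (d + 1) = r := by
    rw [Nat.mul_add_mod]; exact Nat.mod_eq_of_lt (by omega)
  have h2 : ((d + 1) * a + r) / (d + 1) = a := by
    rw [Nat.mul_add_div (Nat.succ_pos d), Nat.div_eq_of_lt (by omega), add_zero]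
  rw [weave, if_neg (by omega), h1, h2]

/-- In the pattern `p p u p p u …` any three consecutive terms contain exactly one `u` and two
consecutive terms of `p`. The bound `3 * k + 1` allows one further term of `p` after the last
inserted one; this is where the two halves meet. -/
theorem weave_two_window {V : Type*} {𝓔 : Set (Set V)} {p u : ℕ → V} {k : ℕ}
    (h : ∀ i < k, ∀ j < 2 * k, ({u i, p j, p (j + 1)} : Set V) ∈ 𝓔) {j : ℕ} (hj : j + 2 < 3 * k + 1) :
    ({weave 2 p u j, weave 2 p u (j + 1), weave 2 p u (j + 2)} : Set V) ∈ 𝓔 := by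
  obtain ⟨a, ha⟩ : ∃ a, a = j / 3 := ⟨_, rfl⟩
  have e0 : weave 2 p u (3 * a) = p (2 * a) := weave_original 2 p u a (r := 0) (by omega)
  have e1 : weave 2 p u (3 * a + 1) = p (2 * a + 1) := weave_original 2 p u a (by omega)
  have e2 : weave 2 p u (3 * a + 2) = u a := weave_inserted 2 p u a
  have e3 : weave 2 p u (3 * a + 3) = p (2 * a + 2) :=
    weave_original 2 p u (a + 1) (r := 0) (by omega)
  have e4 : weave 2 p u (3 * a + 4) = p (2 * a + 3) := weave_original 2 p u (a + 1) (r := 1) (by omega)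
  have hr : j = 3 * a ∨ j = 3 * a + 1 ∨ j = 3 * a + 2 := by omega
  rcases hr with rfl | rfl | rfl
  · rw [e0, e1, e2]
    convert h a (by omega) (2 * a) (by omega) using 1
    ext; simp; tauto
  · rw [e1, e2, e3]
    convert h a (by omega) (2 * a + 1) (by omega) using 1
    ext; simp; tauto
  · rw [e2, e3, e4]
    exact h a (by omega) (2 * a + 2) (by omega)

/-- Any four consecutive terms of `p p p u p p p u …` contain exactly one `u` and three consecutive
terms of `p`. Here the sequence stops at an inserted term. -/
theorem weave_three_window {V : Type*} {𝓔 : Set (Set V)} {p u : ℕ → V} {k : ℕ}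
    (h : ∀ i < k, ∀ j, j + 2 < 3 * k → ({u i, p j, p (j + 1), p (j + 2)} : Set V) ∈ 𝓔)
    {j : ℕ} (hj : j + 3 < 4 * k) :
    ({weave 3 p u j, weave 3 p u (j + 1), weave 3 p u (j + 2), weave 3 p u (j + 3)} : Set V)
      ∈ 𝓔 := by
  obtain ⟨a, ha⟩ : ∃ a, a = j / 4 := ⟨_, rfl⟩
  have e0 : weave 3 p u (4 * a) = p (3 * a) := weave_original 3 p u a (r := 0) (by omega)
  have e1 : weave 3 p u (4 * a + 1) = p (3 * a + 1) := weave_original 3 p u a (by omega)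
  have e2 : weave 3 p u (4 * a + 2) = p (3 * a + 2) := weave_original 3 p u a (by omega)
  have e3 : weave 3 p u (4 * a + 3) = u a := weave_inserted 3 p u a
  have e4 : weave 3 p u (4 * a + 4) = p (3 * a + 3) :=
    weave_original 3 p u (a + 1) (r := 0) (by omega)
  have e5 : weave 3 p u (4 * a + 5) = p (3 * a + 4) :=
    weave_original 3 p u (a + 1) (r := 1) (by omega)
  have e6 : weave 3 p u (4 * a + 6) = p (3 * a + 5) :=
    weave_original 3 p u (a + 1) (r := 2) (by omega)
  have hr : j = 4 * a ∨ j = 4 * a + 1 ∨ j = 4 * a + 2 ∨ j = 4 * a + 3 := by omega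
  rcases hr with rfl | rfl | rfl | rfl
  · rw [e0, e1, e2, e3]
    convert h a (by omega) (3 * a) (by omega) using 1
    ext; simp; tauto
  · rw [e1, e2, e3, e4]
    convert h a (by omega) (3 * a + 1) (by omega) using 1
    ext; simp; tauto
  · rw [e2, e3, e4, e5]
    convert h a (by omega) (3 * a + 2) (by omega) using 1
    ext; simp; tauto
  · rw [e3, e4, e5, e6]
    exact h a (by omega) (3 * a + 3) (by omega)

/-- The first `L` terms of `f`, followed by the first `L` terms of `g` in reverse order. -/
def glue {V : Type*} (L : ℕ) (f g : ℕ → V) (j : ℕ) : V :=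
  if j < L then f j else g (2 * L - 1 - j)

theorem glue_left {V : Type*} {L : ℕ} (f g : ℕ → V) {j : ℕ} (h : j < L) : glue L f g j = f j :=
  if_pos h

theorem glue_right {V : Type*} {L : ℕ} (f g : ℕ → V) {i j : ℕ} (h : i + j + 1 = 2 * L)
    (hi : i < L) : glue L f g j = g i := by
  rw [glue, if_neg (by omega)]
  congr 1
  omega

/-- Only two windows meet both halves, and these are `h1` and `h2`; any other lies in `f` or,
reversed, in `g`. Edges are sets, so the reversal is harmless. -/
theorem glue_window_three {V : Type*} {𝓔 : Set (Set V)} {f g : ℕ → V} {L : ℕ}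
    (hf : ∀ j, j + 2 < L + 2 → ({f j, f (j + 1), f (j + 2)} : Set V) ∈ 𝓔)
    (hg : ∀ j, j + 2 < L + 2 → ({g j, g (j + 1), g (j + 2)} : Set V) ∈ 𝓔)
    (h1 : ({f L, f (L + 1), g (L + 1)} : Set V) ∈ 𝓔)
    (h2 : ({g L, g (L + 1), f (L + 1)} : Set V) ∈ 𝓔) {j : ℕ} (hj : j + 2 < 2 * (L + 2)) :
    ({glue (L + 2) f g j, glue (L + 2) f g (j + 1), glue (L + 2) f g (j + 2)} : Set V) ∈ 𝓔 := by
  by_cases hc : j + 2 < L + 2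
  · rw [glue_left f g (by omega : j < _), glue_left f g (by omega : j + 1 < _), glue_left f g hc]
    exact hf j hc
  by_cases hc' : j = L
  · subst hc'
    rw [glue_left f g (by omega), glue_left f g (by omega),
      glue_right f g (i := j + 1) (by omega) (by omega)]
    exact h1
  by_cases hc'' : j = L + 1
  · subst hc''
    rw [glue_left f g (by omega), glue_right f g (i := L + 1) (by omega) (by omega),
      glue_right f g (i := L) (by omega) (by omega)]
    convert h2 using 1
    ext; simp; tauto
  obtain ⟨i, hi⟩ : ∃ i, i + j + 3 = 2 * (L + 2) := ⟨2 * (L + 2) - (j + 3), by omega⟩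
  rw [glue_right f g (i := i + 2) (by omega) (by omega),
    glue_right f g (i := i + 1) (by omega) (by omega),
    glue_right f g (i := i) (by omega) (by omega)]
  convert hg i (by omega) using 1
  ext; simp; tauto

theorem glue_window_four {V : Type*} {𝓔 : Set (Set V)} {f g : ℕ → V} {L : ℕ}
    (hf : ∀ j, j + 3 < L + 3 → ({f j, f (j + 1), f (j + 2), f (j + 3)} : Set V) ∈ 𝓔)
    (hg : ∀ j, j + 3 < L + 3 → ({g j, g (j + 1), g (j + 2), g (j + 3)} : Set V) ∈ 𝓔)
    (h1 : ({f L, f (L + 1), f (L + 2), g (L + 2)} : Set V) ∈ 𝓔)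
    (h2 : ({f (L + 1), f (L + 2), g (L + 1), g (L + 2)} : Set V) ∈ 𝓔)
    (h3 : ({g L, g (L + 1), g (L + 2), f (L + 2)} : Set V) ∈ 𝓔)
    {j : ℕ} (hj : j + 3 < 2 * (L + 3)) :
    ({glue (L + 3) f g j, glue (L + 3) f g (j + 1), glue (L + 3) f g (j + 2),
      glue (L + 3) f g (j + 3)} : Set V) ∈ 𝓔 := by
  by_cases hc : j + 3 < L + 3
  · rw [glue_left f g (by omega : j < _), glue_left f g (by omega : j + 1 < _),
      glue_left f g (by omega : j + 2 < _), glue_left f g hc]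
    exact hf j hc
  by_cases hc0 : j = L
  · subst hc0
    rw [glue_left f g (by omega), glue_left f g (by omega), glue_left f g (by omega),
      glue_right f g (i := j + 2) (by omega) (by omega)]
    exact h1
  by_cases hc1 : j = L + 1
  · subst hc1
    rw [glue_left f g (by omega), glue_left f g (by omega),
      glue_right f g (i := L + 2) (by omega) (by omega),
      glue_right f g (i := L + 1) (by omega) (by omega)]
    convert h2 using 1
    ext; simp; tauto
  by_cases hc2 : j = L + 2
  · subst hc2
    rw [glue_left f g (by omega), glue_right f g (i := L + 2) (by omega) (by omega),
      glue_right f g (i := L + 1) (by omega) (by omega),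
      glue_right f g (i := L) (by omega) (by omega)]
    convert h3 using 1
    ext; simp; tauto
  obtain ⟨i, hi⟩ : ∃ i, i + j + 4 = 2 * (L + 3) := ⟨2 * (L + 3) - (j + 4), by omega⟩
  rw [glue_right f g (i := i + 3) (by omega) (by omega),
    glue_right f g (i := i + 2) (by omega) (by omega),
    glue_right f g (i := i + 1) (by omega) (by omega),
    glue_right f g (i := i) (by omega) (by omega)]
  convert hg i (by omega) using 1
  ext; simp; tauto

/-- Both halves of a glued sequence can be recovered from it. -/
theorem glue_injective {V : Type*} {L : ℕ} {f g f' g' : ℕ → V}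
    (h : ∀ j < 2 * L, glue L f g j = glue L f' g' j) :
    (∀ j < L, f j = f' j) ∧ ∀ j < L, g j = g' j := by
  refine ⟨fun j hj => ?_, fun j hj => ?_⟩
  · have := h j (by omega)
    rwa [glue_left _ _ hj, glue_left _ _ hj] at this
  · have := h (2 * L - 1 - j) (by omega)
    rwa [glue_right f g (i := j) (by omega) hj, glue_right f' g' (i := j) (by omega) hj] at this

theorem weave_inserted_injective {V : Type*} {d L k : ℕ} {p u p' u' : ℕ → V}
    (h : ∀ j < L, weave d p u j = weave d p' u' j) (hk : (d + 1) * k ≤ L) {i : ℕ} (hi : i < k) :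
    u i = u' i := by
  have := h ((d + 1) * i + d) (by nlinarith)
  rwa [weave_inserted, weave_inserted] at this

theorem weave_original_injective {V : Type*} {d L : ℕ} {p u p' u' : ℕ → V}
    (h : ∀ j < L, weave d p u j = weave d p' u' j) {a r : ℕ} (hr : r < d)
    (ha : (d + 1) * a + r < L) : p (d * a + r) = p' (d * a + r) := by
  have := h ((d + 1) * a + r) ha
  rwa [weave_original _ _ _ _ hr, weave_original _ _ _ _ hr] at this

/-- The path built from two sequences `a, p` and `e, p'` by inserting the first, respectively the
second, components of `y` after every `d` terms, and reversing the second sequence. -/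
def doubleWeave {V : Type*} {s m : ℕ} (d L : ℕ) (a e : V) (p p' : Fin s → V)
    (y : Fin m → V × V) : ℕ → V :=
  glue L (weave d (extendCons a p) fun i => extendCons a (fun t => (y t).1) (i + 1))
    (weave d (extendCons e p') fun i => extendCons a (fun t => (y t).2) (i + 1))

/-- This makes the passage from configurations to walks injective, so that counts carry over. The
original terms are read off their positions, which `hs` places inside the half, and the inserted
ones off theirs. -/
theorem doubleWeave_injective {V : Type*} {s m d L : ℕ} {a e : V} {p p' q q' : Fin s → V}
    {y z : Fin m → V × V} (hm : (d + 1) * m ≤ L) (hd : 0 < d)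
    (hs : ∀ i, i < s + 1 → (d + 1) * (i / d) + i % d < L)
    (h : ∀ j < 2 * L, doubleWeave d L a e p p' y j = doubleWeave d L a e q q' z j) :
    p = q ∧ p' = q' ∧ y = z := by
  obtain ⟨hP, hQ⟩ := glue_injective h
  refine ⟨funext fun ⟨i, hi⟩ => ?_, funext fun ⟨i, hi⟩ => ?_, funext fun ⟨i, hi⟩ => ?_⟩
  · have := weave_original_injective hP (Nat.mod_lt (i + 1) hd) (hs (i + 1) (by omega))
    rwa [Nat.div_add_mod, extendCons_succ _ _ hi, extendCons_succ _ _ hi] at this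
  · have := weave_original_injective hQ (Nat.mod_lt (i + 1) hd) (hs (i + 1) (by omega))
    rwa [Nat.div_add_mod, extendCons_succ _ _ hi, extendCons_succ _ _ hi] at this
  · have h1 := weave_inserted_injective hP hm hi
    have h2 := weave_inserted_injective hQ hm hi
    simp only [extendCons_succ _ _ hi] at h1 h2
    exact Prod.ext h1 h2

/-! ### Tight walks in `3`-uniform hypergraphs -/

open Finset Classical in
/-- Counting pairs of walks, one in `G u` from `c` and one in `G u'` from `d`, whose last vertices
are joined by a common edge of the two graphs. -/
theorem le_card_walk_pairs {V : Type*} [Fintype V] (A B : V → V → Prop) (k : ℕ) {β γ : ℝ}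
    (hβ : 0 ≤ β) (c d : V)
    (hA : ∀ x, (∃ x', A x x') → c ≠ x → β * (Fintype.card V : ℝ) ^ (2 * k) ≤
      #{p : Fin (2 * k + 2) → V | p 0 = c ∧ p (Fin.last _) = x ∧
        ∀ i : Fin (2 * k + 1), A (p i.castSucc) (p i.succ)})
    (hB : ∀ x, (∃ x', B x x') → d ≠ x → β * (Fintype.card V : ℝ) ^ (2 * k) ≤
      #{p : Fin (2 * k + 2) → V | p 0 = d ∧ p (Fin.last _) = x ∧
        ∀ i : Fin (2 * k + 1), B (p i.castSucc) (p i.succ)})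
    (hAB : γ * (Fintype.card V : ℝ) ^ 2 ≤ #{x : V × V | A x.1 x.2 ∧ B x.2 x.1})
    (hn : 4 ≤ γ * Fintype.card V) :
    γ / 2 * (Fintype.card V : ℝ) ^ 2 * (β * (Fintype.card V : ℝ) ^ (2 * k)) ^ 2 ≤
      #{x ∈ ({p : Fin (2 * k + 2) → V | p 0 = c} : Finset _) ×ˢ
          ({p : Fin (2 * k + 2) → V | p 0 = d} : Finset _) |
        (∀ i : Fin (2 * k + 1), A (x.1 i.castSucc) (x.1 i.succ)) ∧
        (∀ i : Fin (2 * k + 1), B (x.2 i.castSucc) (x.2 i.succ)) ∧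
        A (x.1 (Fin.last _)) (x.2 (Fin.last _)) ∧ B (x.2 (Fin.last _)) (x.1 (Fin.last _))} := by
  set n : ℝ := (Fintype.card V : ℝ) with hn_def
  -- Walks are only guaranteed between distinct vertices, so ends equal to `c` or `d` are avoided.
  -- This costs at most `2n` pairs, half of the supply because `4 ≤ γ n`.
  have hcard : γ / 2 * n ^ 2 ≤
      #{x : V × V | (A x.1 x.2 ∧ B x.2 x.1) ∧ c ≠ x.1 ∧ d ≠ x.2} := by
    have h1 : ({x : V × V | A x.1 x.2 ∧ B x.2 x.1} : Finset _) ⊆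
        ({x : V × V | (A x.1 x.2 ∧ B x.2 x.1) ∧ c ≠ x.1 ∧ d ≠ x.2} : Finset _) ∪
          (({c} : Finset V) ×ˢ univ ∪ univ ×ˢ ({d} : Finset V)) := by
      intro x hx
      simp only [mem_filter, mem_univ, true_and, mem_union, mem_product, mem_singleton,
        and_true] at hx ⊢
      by_cases h1 : x.1 = c
      · exact Or.inr (Or.inl h1)
      · by_cases h2 : x.2 = d
        · exact Or.inr (Or.inr h2)
        · exact Or.inl ⟨hx, Ne.symm h1, Ne.symm h2⟩
    have h2 := (card_le_card h1).trans ((card_union_le _ _).trans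
      (Nat.add_le_add_left (card_union_le _ _) _))
    simp only [card_product, card_singleton, card_univ, one_mul, mul_one] at h2
    have h3 : (#{x : V × V | A x.1 x.2 ∧ B x.2 x.1} : ℝ) ≤
        #{x : V × V | (A x.1 x.2 ∧ B x.2 x.1) ∧ c ≠ x.1 ∧ d ≠ x.2} + (n + n) := by
      rw [hn_def]
      exact_mod_cast h2
    have h4 : (0 : ℝ) ≤ n := Nat.cast_nonneg _
    nlinarith
  refine le_trans ?_ (card_mul_le_card_of_le_fiber _
    ({x : V × V | (A x.1 x.2 ∧ B x.2 x.1) ∧ c ≠ x.1 ∧ d ≠ x.2} : Finset _)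
    (fun x => (x.1 (Fin.last _), x.2 (Fin.last _))) ((β * n ^ (2 * k)) ^ 2) ?_)
  · gcongr
  · rintro ⟨x, y⟩ hxy
    simp only [mem_filter, mem_univ, true_and] at hxy
    obtain ⟨⟨hA', hB'⟩, hcx, hdy⟩ := hxy
    have h1 := hA x ⟨y, hA'⟩ hcx
    have h2 := hB y ⟨x, hB'⟩ hdy
    have h3 := mul_le_mul h1 h2 (by positivity) (Nat.cast_nonneg _)
    rw [← sq, ← Nat.cast_mul, ← card_product] at h3
    refine h3.trans ?_
    refine Nat.cast_le.2 (card_le_card fun p hp => ?_)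
    simp only [mem_filter, mem_univ, true_and, mem_product] at hp ⊢
    obtain ⟨⟨p0, p1, p2⟩, ⟨q0, q1, q2⟩⟩ := hp
    exact ⟨⟨⟨p0, q0⟩, p2, q2, by rwa [p1, q1], by rwa [p1, q1]⟩, by rw [p1, q1]⟩

/-- The interleaving of two graph walks with vertices whose link graphs contain them is a tight
walk in a `3`-uniform hypergraph. -/
theorem doubleWeave_two_tight {V : Type*} {𝓔 : Set (Set V)} {G : V → V → V → Prop}
    (hG : ∀ u x y, G u x y → ({u, x, y} : Set V) ∈ 𝓔) {k : ℕ} {b c d e : V}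
    {p p' : Fin (2 * k + 2) → V} {y : Fin (k + 1) → V × V} (hp : p 0 = c) (hp' : p' 0 = d)
    (hc : ∀ t, G (y t).1 b c) (hd : ∀ t, G (y t).2 e d)
    (hw : ∀ t, ∀ i : Fin (2 * k + 1), G (y t).1 (p i.castSucc) (p i.succ))
    (hw' : ∀ t, ∀ i : Fin (2 * k + 1), G (y t).2 (p' i.castSucc) (p' i.succ))
    (hl : ∀ t, G (y t).1 (p (Fin.last _)) (p' (Fin.last _)))
    (hl' : ∀ t, G (y t).2 (p' (Fin.last _)) (p (Fin.last _))) :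
    (doubleWeave 2 (3 * k + 2 + 2) b e p p' y 0 = b ∧ doubleWeave 2 (3 * k + 2 + 2) b e p p' y 1 = c) ∧
      doubleWeave 2 (3 * k + 2 + 2) b e p p' y (6 * k + 6) = d ∧
      doubleWeave 2 (3 * k + 2 + 2) b e p p' y (6 * k + 7) = e ∧
      ∀ i, i + 2 < 6 * k + 8 → ({doubleWeave 2 (3 * k + 2 + 2) b e p p' y i,
        doubleWeave 2 (3 * k + 2 + 2) b e p p' y (i + 1),
        doubleWeave 2 (3 * k + 2 + 2) b e p p' y (i + 2)} : Set V) ∈ 𝓔 := by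
  unfold doubleWeave
  have hP0 : extendCons b p 0 = b := rfl
  have hQ0 : extendCons e p' 0 = e := rfl
  have hP1 : extendCons b p (0 + 1) = c := (extendCons_succ b p (i := 0) (by omega)).trans hp
  have hQ1 : extendCons e p' (0 + 1) = d := (extendCons_succ e p' (i := 0) (by omega)).trans hp'
  have hP : ∀ i < k + 1, ∀ j < 2 * (k + 1),
      ({extendCons b (fun t => (y t).1) (i + 1), extendCons b p j, extendCons b p (j + 1)} :
        Set V) ∈ 𝓔 := fun i hi j hj => by
    refine hG _ _ _ ?_
    rw [extendCons_succ _ _ hi]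
    rcases j with _ | j
    · rw [hP0, hP1]
      exact hc _
    · rw [extendCons_succ b p (i := j) (by omega), extendCons_succ b p (i := j + 1) (by omega)]
      exact hw _ ⟨j, by omega⟩
  have hQ : ∀ i < k + 1, ∀ j < 2 * (k + 1),
      ({extendCons b (fun t => (y t).2) (i + 1), extendCons e p' j, extendCons e p' (j + 1)} :
        Set V) ∈ 𝓔 := fun i hi j hj => by
    refine hG _ _ _ ?_
    rw [extendCons_succ _ _ hi]
    rcases j with _ | j
    · rw [hQ0, hQ1]
      exact hd _
    · rw [extendCons_succ e p' (i := j) (by omega), extendCons_succ e p' (i := j + 1) (by omega)]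
      exact hw' _ ⟨j, by omega⟩
  have hPl : extendCons b p (2 * (k + 1) + 0) = p (Fin.last _) :=
    extendCons_succ b p (i := 2 * k + 1) (by omega)
  have hQl : extendCons e p' (2 * (k + 1) + 0) = p' (Fin.last _) :=
    extendCons_succ e p' (i := 2 * k + 1) (by omega)
  set P := extendCons b p
  set Q := extendCons e p'
  -- The shift skips the head of `extendCons`: the inserted terms are exactly the `(y t).1`, and `b`
  -- is only padding beyond them.
  set u : ℕ → V := fun i => extendCons b (fun t => (y t).1) (i + 1)
  set u' : ℕ → V := fun i => extendCons b (fun t => (y t).2) (i + 1)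
  have hu : u k = (y ⟨k, by omega⟩).1 := extendCons_succ _ _ (Nat.lt_succ_self k)
  have hu' : u' k = (y ⟨k, by omega⟩).2 := extendCons_succ _ _ (Nat.lt_succ_self k)
  refine ⟨⟨?_, ?_⟩, ?_, ?_, fun i hi => ?_⟩
  · rw [glue_left _ _ (by omega)]
    exact hP0
  · rw [glue_left _ _ (by omega)]
    exact (weave_original 2 P u 0 (r := 1) (by omega)).trans hP1
  · rw [glue_right _ _ (i := 1) (by omega) (by omega)]
    exact (weave_original 2 Q u' 0 (r := 1) (by omega)).trans hQ1
  · rw [glue_right _ _ (i := 0) (by omega) (by omega)]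
    exact hQ0
  · have hPw : weave 2 P u (3 * k + 2 + 1) = p (Fin.last _) :=
      (weave_original 2 P u (k + 1) (r := 0) (by omega)).trans hPl
    have hQw : weave 2 Q u' (3 * k + 2 + 1) = p' (Fin.last _) :=
      (weave_original 2 Q u' (k + 1) (r := 0) (by omega)).trans hQl
    have hPk : weave 2 P u (3 * k + 2) = (y ⟨k, by omega⟩).1 := (weave_inserted 2 P u k).trans hu
    have hQk : weave 2 Q u' (3 * k + 2) = (y ⟨k, by omega⟩).2 :=
      (weave_inserted 2 Q u' k).trans hu'
    refine glue_window_three (L := 3 * k + 2)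
      (fun j hj => weave_two_window (k := k + 1) (j := j) hP (by omega))
      (fun j hj => weave_two_window (k := k + 1) (j := j) hQ (by omega)) ?_ ?_ (by omega)
    · rw [hPk, hPw, hQw]
      exact hG _ _ _ (hl _)
    · rw [hQk, hPw, hQw]
      exact hG _ _ _ (hl' _)

open Finset Classical in
/-- Let `𝓔` be a `3`-uniform hypergraph containing `uxy` for every edge `xy` of a graph `G u`.
If the graphs `G u` with `u ∈ U` are robust and pairwise share many edges, then there are many
tight walks in `𝓔` between two pairs that belong to `G u` for many `u ∈ U`. -/
theorem le_card_tight_walks {V : Type*} [Fintype V] {𝓔 : Set (Set V)} (G : V → V → V → Prop)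
    (hG : ∀ u x y, G u x y → ({u, x, y} : Set V) ∈ 𝓔) (U : Finset V) (k : ℕ) {β γ ζ : ℝ}
    (hβ : 0 ≤ β) (hγ : 0 ≤ γ) (hζ : 0 ≤ ζ)
    (hwalk : ∀ u ∈ U, ∀ x y, (∃ x', G u x x') → (∃ y', G u y y') → x ≠ y →
      β * (Fintype.card V : ℝ) ^ (2 * k) ≤
      #{p : Fin (2 * k + 2) → V | p 0 = x ∧ p (Fin.last _) = y ∧
        ∀ i : Fin (2 * k + 1), G u (p i.castSucc) (p i.succ)})
    (hcommon : ∀ u ∈ U, ∀ u' ∈ U, γ * (Fintype.card V : ℝ) ^ 2 ≤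
      #{x : V × V | G u x.1 x.2 ∧ G u' x.2 x.1})
    (hn : 4 ≤ γ * Fintype.card V) (b c d e : V)
    (hbc : ζ * Fintype.card V ≤ #{u ∈ U | G u b c ∧ ∃ x, G u c x})
    (hde : ζ * Fintype.card V ≤ #{u ∈ U | G u e d ∧ ∃ x, G u d x}) :
    (ζ ^ 2 * (γ / 2) * β ^ 2) ^ (k + 1) * (Fintype.card V : ℝ) ^ (6 * k + 4) ≤
      #{q : Fin (6 * k + 6 + 2) → V | (q 0 = b ∧ q 1 = c) ∧ q ⟨6 * k + 6, by omega⟩ = d ∧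
        q ⟨6 * k + 7, by omega⟩ = e ∧ ∀ (i : ℕ) (hi : i + 2 < 6 * k + 8),
          ({q ⟨i, by omega⟩, q ⟨i + 1, by omega⟩, q ⟨i + 2, hi⟩} : Set V) ∈ 𝓔} := by
  set n : ℝ := (Fintype.card V : ℝ) with hn_def
  have hn0 : 0 < n := by
    rw [hn_def]; exact_mod_cast Fintype.card_pos_iff.2 ⟨b⟩
  set S := ({p : Fin (2 * k + 2) → V | p 0 = c} : Finset _) ×ˢ
    ({p : Fin (2 * k + 2) → V | p 0 = d} : Finset _)
  -- The relation `r` requires a single pair of inserted vertices to be compatible with the whole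
  -- pair of walks. After the blow-up every inserted pair fits at every position.
  obtain ⟨r, hr⟩ : ∃ r : (Fin (2 * k + 2) → V) × (Fin (2 * k + 2) → V) → V × V → Prop,
      ∀ x y, r x y ↔ (G y.1 b c ∧ G y.2 e d) ∧
        (∀ i : Fin (2 * k + 1), G y.1 (x.1 i.castSucc) (x.1 i.succ)) ∧
        (∀ i : Fin (2 * k + 1), G y.2 (x.2 i.castSucc) (x.2 i.succ)) ∧
        G y.1 (x.1 (Fin.last _)) (x.2 (Fin.last _)) ∧
        G y.2 (x.2 (Fin.last _)) (x.1 (Fin.last _)) := ⟨_, fun _ _ => Iff.rfl⟩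
  have hS : (#S : ℝ) ≤ n ^ (4 * k + 2) := by
    have := Nat.mul_le_mul (card_filter_apply_zero_le (2 * k + 1) c)
      (card_filter_apply_zero_le (2 * k + 1) d)
    rw [← card_product, ← pow_add] at this
    rw [hn_def, show 4 * k + 2 = 2 * k + 1 + (2 * k + 1) by ring]
    exact_mod_cast this
  -- Each of the `ζ² n²` pairs `(u, u')` admits `γ / 2 * n ^ 2 * (β * n ^ (2 * k)) ^ 2` pairs of
  -- walks: a positive proportion of `n ^ (4 * k + 2) * n ^ 2`.
  have hdense : (ζ ^ 2 * (γ / 2) * β ^ 2) * n ^ (4 * k + 2) * n ^ 2 ≤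
      #{x ∈ S ×ˢ (univ : Finset (V × V)) | r x.1 x.2} := by
    refine le_trans ?_ (card_mul_le_card_of_le_fiber _
      (({u ∈ U | G u b c ∧ ∃ x, G u c x} : Finset _) ×ˢ
        ({u ∈ U | G u e d ∧ ∃ x, G u d x} : Finset _))
      (fun x => x.2) (γ / 2 * n ^ 2 * (β * n ^ (2 * k)) ^ 2) ?_)
    · rw [card_product, Nat.cast_mul]
      have := mul_le_mul hbc hde (by positivity) (Nat.cast_nonneg _)
      calc _ = (ζ * n * (ζ * n)) * (γ / 2 * n ^ 2 * (β * n ^ (2 * k)) ^ 2) := by ring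
        _ ≤ _ := by gcongr
    · rintro ⟨u, u'⟩ hu
      simp only [mem_product, mem_filter] at hu
      obtain ⟨⟨hu, hub, huc⟩, ⟨hu', hue, hud⟩⟩ := hu
      refine (le_card_walk_pairs (G u) (G u') k hβ c d
        (fun x hx hcx => hwalk u hu c x huc hx hcx)
        (fun x hx hcx => hwalk u' hu' d x hud hx hcx) (hcommon u hu u' hu') hn).trans ?_
      refine Nat.cast_le.2 (card_le_card_of_injOn (fun x => (x, (u, u'))) (fun x hx => ?_)
        fun x _ y _ hxy => congrArg Prod.fst hxy)
      obtain ⟨hxS, hxr⟩ := mem_filter.1 (mem_coe.1 hx)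
      exact mem_coe.2 (mem_filter.2 ⟨mem_filter.2 ⟨mem_product.2 ⟨hxS, mem_univ _⟩,
        (hr _ _).2 ⟨⟨hub, hue⟩, hxr⟩⟩, rfl⟩)
  have hblow := le_card_blowup S r (by positivity) (by positivity) (by positivity) hS hdense k
  have hpow : n ^ (6 * k + 4) = n ^ (4 * k + 2) * (n ^ 2) ^ (k + 1) := by
    rw [← pow_mul, ← pow_add]
    congr 1
    ring
  rw [hpow, ← mul_assoc]
  refine hblow.trans (Nat.cast_le.2 ?_)
  refine card_le_card_of_injOn
    (fun x (j : Fin (6 * k + 6 + 2)) => doubleWeave 2 (3 * k + 2 + 2) b e x.1.1 x.1.2 x.2 j) ?_ ?_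
  · rintro ⟨⟨p, p'⟩, y⟩ hx
    obtain ⟨hxS, hr'⟩ := mem_filter.1 (mem_coe.1 hx)
    replace hr := fun t => (hr _ _).1 (hr' t)
    obtain ⟨hp, hp'⟩ := mem_product.1 (mem_product.1 hxS).1
    refine mem_coe.2 (mem_filter.2 ⟨mem_univ _, ?_⟩)
    obtain ⟨⟨h1, h2⟩, h3⟩ := doubleWeave_two_tight hG (mem_filter.1 hp).2 (mem_filter.1 hp').2
      (fun t => (hr t).1.1) (fun t => (hr t).1.2) (fun t => (hr t).2.1) (fun t => (hr t).2.2.1)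
      (fun t => (hr t).2.2.2.1) (fun t => (hr t).2.2.2.2)
    exact ⟨⟨by beta_reduce; rw [Fin.val_zero]; exact h1, by beta_reduce; rw [Fin.val_one]; exact h2⟩, h3⟩
  · rintro ⟨⟨p, p'⟩, y⟩ - ⟨⟨q, q'⟩, z⟩ - hxy
    obtain ⟨rfl, rfl, rfl⟩ := doubleWeave_injective (m := k + 1) (L := 3 * k + 2 + 2) (by omega)
      (by omega) (fun i hi => by omega) (fun j hj => congrFun hxy ⟨j, by omega⟩)
    rfl

/-! ### Tight walks in `4`-uniform hypergraphs -/

/-- Interleaving two tight walks of a `3`-uniform hypergraph with vertices whose links contain them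
gives a tight walk in a `4`-uniform hypergraph. -/
theorem doubleWeave_three_tight {V : Type*} {𝓔 : Set (Set V)} {k : ℕ} {a b c x y z : V}
    {q q' : Fin (6 * k + 6 + 2) → V} {w : Fin (2 * k + 2 + 1) → V × V}
    (hq : q 0 = b ∧ q 1 = c) (hq' : q' 0 = y ∧ q' 1 = x)
    (ha : ∀ t, ({(w t).1, a, b, c} : Set V) ∈ 𝓔) (hz : ∀ t, ({(w t).2, z, y, x} : Set V) ∈ 𝓔)
    (hw : ∀ t, ∀ (i : ℕ) (hi : i + 2 < 6 * k + 8),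
      ({(w t).1, q ⟨i, by omega⟩, q ⟨i + 1, by omega⟩, q ⟨i + 2, hi⟩} : Set V) ∈ 𝓔)
    (hw' : ∀ t, ∀ (i : ℕ) (hi : i + 2 < 6 * k + 8),
      ({(w t).2, q' ⟨i, by omega⟩, q' ⟨i + 1, by omega⟩, q' ⟨i + 2, hi⟩} : Set V) ∈ 𝓔)
    (h1 : ∀ t, ({q ⟨6 * k + 6, by omega⟩, q ⟨6 * k + 7, by omega⟩, (w t).1, (w t).2} : Set V) ∈ 𝓔)
    (h2 : ∀ t, ({q ⟨6 * k + 7, by omega⟩, (w t).1, q' ⟨6 * k + 7, by omega⟩, (w t).2} : Set V) ∈ 𝓔)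
    (h3 : ∀ t, ({q' ⟨6 * k + 6, by omega⟩, q' ⟨6 * k + 7, by omega⟩, (w t).2, (w t).1} : Set V)
      ∈ 𝓔) :
    (doubleWeave 3 (8 * k + 9 + 3) a z q q' w 0 = a ∧
      doubleWeave 3 (8 * k + 9 + 3) a z q q' w 1 = b ∧
      doubleWeave 3 (8 * k + 9 + 3) a z q q' w 2 = c ∧
      doubleWeave 3 (8 * k + 9 + 3) a z q q' w (16 * k + 21) = x ∧
      doubleWeave 3 (8 * k + 9 + 3) a z q q' w (16 * k + 22) = y ∧
      doubleWeave 3 (8 * k + 9 + 3) a z q q' w (16 * k + 23) = z) ∧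
    ∀ i, i + 3 < 16 * k + 24 → ({doubleWeave 3 (8 * k + 9 + 3) a z q q' w i,
        doubleWeave 3 (8 * k + 9 + 3) a z q q' w (i + 1),
        doubleWeave 3 (8 * k + 9 + 3) a z q q' w (i + 2),
        doubleWeave 3 (8 * k + 9 + 3) a z q q' w (i + 3)} : Set V) ∈ 𝓔 := by
  unfold doubleWeave
  have hP0 : extendCons a q 0 = a := rfl
  have hQ0 : extendCons z q' 0 = z := rfl
  have hP1 : extendCons a q 1 = b := (extendCons_succ a q (i := 0) (by omega)).trans hq.1
  have hQ1 : extendCons z q' 1 = y := (extendCons_succ z q' (i := 0) (by omega)).trans hq'.1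
  have hP2 : extendCons a q 2 = c := (extendCons_succ a q (i := 1) (by omega)).trans hq.2
  have hQ2 : extendCons z q' 2 = x := (extendCons_succ z q' (i := 1) (by omega)).trans hq'.2
  have hP : ∀ i < 2 * k + 3, ∀ j, j + 2 < 3 * (2 * k + 3) →
      ({extendCons a (fun t => (w t).1) (i + 1), extendCons a q j, extendCons a q (j + 1),
        extendCons a q (j + 2)} : Set V) ∈ 𝓔 := fun i hi j hj => by
    rw [extendCons_succ _ _ hi]
    rcases j with _ | j
    · rw [hP0, zero_add, zero_add, hP1, hP2]
      exact ha _
    · rw [extendCons_succ a q (i := j) (by omega), extendCons_succ a q (i := j + 1) (by omega),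
        extendCons_succ a q (i := j + 2) (by omega)]
      exact hw _ j (by omega)
  have hQ : ∀ i < 2 * k + 3, ∀ j, j + 2 < 3 * (2 * k + 3) →
      ({extendCons a (fun t => (w t).2) (i + 1), extendCons z q' j, extendCons z q' (j + 1),
        extendCons z q' (j + 2)} : Set V) ∈ 𝓔 := fun i hi j hj => by
    rw [extendCons_succ _ _ hi]
    rcases j with _ | j
    · rw [hQ0, zero_add, zero_add, hQ1, hQ2]
      exact hz _
    · rw [extendCons_succ z q' (i := j) (by omega), extendCons_succ z q' (i := j + 1) (by omega),
        extendCons_succ z q' (i := j + 2) (by omega)]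
      exact hw' _ j (by omega)
  have hPl : extendCons a q (6 * k + 7) = q ⟨6 * k + 6, by omega⟩ := extendCons_succ a q (by omega)
  have hQl : extendCons z q' (6 * k + 7) = q' ⟨6 * k + 6, by omega⟩ :=
    extendCons_succ z q' (by omega)
  have hPl' : extendCons a q (6 * k + 8) = q ⟨6 * k + 7, by omega⟩ :=
    extendCons_succ a q (by omega)
  have hQl' : extendCons z q' (6 * k + 8) = q' ⟨6 * k + 7, by omega⟩ :=
    extendCons_succ z q' (by omega)
  set P := extendCons a q
  set Q := extendCons z q'
  set u : ℕ → V := fun i => extendCons a (fun t => (w t).1) (i + 1)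
  set u' : ℕ → V := fun i => extendCons a (fun t => (w t).2) (i + 1)
  have hu : u (2 * k + 2) = (w ⟨2 * k + 2, by omega⟩).1 := extendCons_succ _ _ (by omega)
  have hu' : u' (2 * k + 2) = (w ⟨2 * k + 2, by omega⟩).2 := extendCons_succ _ _ (by omega)
  have e (p v : ℕ → V) : weave 3 p v 0 = p 0 ∧ weave 3 p v 1 = p 1 ∧ weave 3 p v 2 = p 2 :=
    ⟨rfl, rfl, rfl⟩
  -- Each half ends with two original terms and one inserted term, since `8k + 9 = 4(2k + 2) + 1`.
  have e' (p v : ℕ → V) : weave 3 p v (8 * k + 9) = p (6 * k + 7) ∧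
      weave 3 p v (8 * k + 9 + 1) = p (6 * k + 8) ∧
      weave 3 p v (8 * k + 9 + 2) = v (2 * k + 2) := by
    refine ⟨?_, ?_, ?_⟩
    · convert weave_original 3 p v (2 * k + 2) (r := 1) (by omega) using 2 <;> ring
    · convert weave_original 3 p v (2 * k + 2) (r := 2) (by omega) using 2 <;> ring
    · convert weave_inserted 3 p v (2 * k + 2) using 2
      ring
  refine ⟨⟨?_, ?_, ?_, ?_, ?_, ?_⟩, fun i hi => ?_⟩
  · rw [glue_left _ _ (by omega), (e _ _).1, hP0]
  · rw [glue_left _ _ (by omega), (e _ _).2.1, hP1]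
  · rw [glue_left _ _ (by omega), (e _ _).2.2, hP2]
  · rw [glue_right _ _ (i := 2) (by omega) (by omega), (e _ _).2.2, hQ2]
  · rw [glue_right _ _ (i := 1) (by omega) (by omega), (e _ _).2.1, hQ1]
  · rw [glue_right _ _ (i := 0) (by omega) (by omega), (e _ _).1, hQ0]
  · refine glue_window_four (L := 8 * k + 9)
      (fun j hj => weave_three_window (k := 2 * k + 3) (j := j) hP (by omega))
      (fun j hj => weave_three_window (k := 2 * k + 3) (j := j) hQ (by omega)) ?_ ?_ ?_ (by omega)
    · rw [(e' P u).1, (e' P u).2.1, (e' P u).2.2, (e' Q u').2.2, hPl, hPl', hu, hu']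
      exact h1 _
    · rw [(e' P u).2.1, (e' P u).2.2, (e' Q u').2.1, (e' Q u').2.2, hPl', hQl', hu, hu']
      exact h2 _
    · rw [(e' Q u').1, (e' Q u').2.1, (e' Q u').2.2, (e' P u).2.2, hQl, hQl', hu, hu']
      exact h3 _

open Finset Classical in
/-- Many tight walks in a `4`-uniform hypergraph, built from tight walks in the links of `v` and
`w` and a connection of their last two vertices in the link of `vw`. -/
theorem le_card_tight_walks_four {V : Type*} [Fintype V] {𝓔 : Set (Set V)} (k : ℕ)
    (a b c x y z : V) (K : Finset ((V × V) × (V × V) × (V × V))) {κ δ : ℝ} (hκ : 0 ≤ κ)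
    (hδ : 0 ≤ δ) (hK : κ * (Fintype.card V : ℝ) ^ 6 ≤ #K)
    (hv : ∀ t ∈ K, ({t.1.1, a, b, c} : Set V) ∈ 𝓔) (hw : ∀ t ∈ K, ({t.1.2, z, y, x} : Set V) ∈ 𝓔)
    (h1 : ∀ t ∈ K, ({t.2.1.1, t.2.1.2, t.1.1, t.1.2} : Set V) ∈ 𝓔)
    (h2 : ∀ t ∈ K, ({t.2.1.2, t.1.1, t.2.2.2, t.1.2} : Set V) ∈ 𝓔)
    (h3 : ∀ t ∈ K, ({t.2.2.1, t.2.2.2, t.1.2, t.1.1} : Set V) ∈ 𝓔)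
    (hqv : ∀ t ∈ K, δ * (Fintype.card V : ℝ) ^ (6 * k + 4) ≤
      #{q : Fin (6 * k + 6 + 2) → V | (q 0 = b ∧ q 1 = c) ∧ q ⟨6 * k + 6, by omega⟩ = t.2.1.1 ∧
        q ⟨6 * k + 7, by omega⟩ = t.2.1.2 ∧ ∀ (i : ℕ) (hi : i + 2 < 6 * k + 8),
          ({t.1.1, q ⟨i, by omega⟩, q ⟨i + 1, by omega⟩, q ⟨i + 2, hi⟩} : Set V) ∈ 𝓔})
    (hqw : ∀ t ∈ K, δ * (Fintype.card V : ℝ) ^ (6 * k + 4) ≤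
      #{q : Fin (6 * k + 6 + 2) → V | (q 0 = y ∧ q 1 = x) ∧ q ⟨6 * k + 6, by omega⟩ = t.2.2.1 ∧
        q ⟨6 * k + 7, by omega⟩ = t.2.2.2 ∧ ∀ (i : ℕ) (hi : i + 2 < 6 * k + 8),
          ({t.1.2, q ⟨i, by omega⟩, q ⟨i + 1, by omega⟩, q ⟨i + 2, hi⟩} : Set V) ∈ 𝓔}) :
    (κ * δ ^ 2) ^ (2 * k + 3) * (Fintype.card V : ℝ) ^ (16 * k + 18) ≤
      #{p : Fin (16 * k + 24) → V | (p ⟨0, by omega⟩ = a ∧ p ⟨1, by omega⟩ = b ∧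
        p ⟨2, by omega⟩ = c ∧ p ⟨16 * k + 21, by omega⟩ = x ∧ p ⟨16 * k + 22, by omega⟩ = y ∧
        p ⟨16 * k + 23, by omega⟩ = z) ∧ ∀ (i : ℕ) (hi : i + 3 < 16 * k + 24),
          ({p ⟨i, by omega⟩, p ⟨i + 1, by omega⟩, p ⟨i + 2, by omega⟩, p ⟨i + 3, hi⟩} : Set V)
            ∈ 𝓔} := by
  set n : ℝ := (Fintype.card V : ℝ) with hn_def
  have hn0 : 0 < n := by
    rw [hn_def]; exact_mod_cast Fintype.card_pos_iff.2 ⟨b⟩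
  set S := ({q : Fin (6 * k + 6 + 2) → V | q 0 = b ∧ q 1 = c} : Finset _) ×ˢ
    ({q : Fin (6 * k + 6 + 2) → V | q 0 = y ∧ q 1 = x} : Finset _)
  obtain ⟨r, hr⟩ : ∃ r : (Fin (6 * k + 6 + 2) → V) × (Fin (6 * k + 6 + 2) → V) → V × V → Prop,
      ∀ q t, r q t ↔ (({t.1, a, b, c} : Set V) ∈ 𝓔 ∧ ({t.2, z, y, x} : Set V) ∈ 𝓔) ∧
        ((∀ (i : ℕ) (hi : i + 2 < 6 * k + 8),
          ({t.1, q.1 ⟨i, by omega⟩, q.1 ⟨i + 1, by omega⟩, q.1 ⟨i + 2, hi⟩} : Set V) ∈ 𝓔) ∧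
        (∀ (i : ℕ) (hi : i + 2 < 6 * k + 8),
          ({t.2, q.2 ⟨i, by omega⟩, q.2 ⟨i + 1, by omega⟩, q.2 ⟨i + 2, hi⟩} : Set V) ∈ 𝓔)) ∧
        ({q.1 ⟨6 * k + 6, by omega⟩, q.1 ⟨6 * k + 7, by omega⟩, t.1, t.2} : Set V) ∈ 𝓔 ∧
        ({q.1 ⟨6 * k + 7, by omega⟩, t.1, q.2 ⟨6 * k + 7, by omega⟩, t.2} : Set V) ∈ 𝓔 ∧
        ({q.2 ⟨6 * k + 6, by omega⟩, q.2 ⟨6 * k + 7, by omega⟩, t.2, t.1} : Set V) ∈ 𝓔 :=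
    ⟨_, fun _ _ => Iff.rfl⟩
  have hS : (#S : ℝ) ≤ n ^ (12 * k + 12) := by
    have := Nat.mul_le_mul (card_filter_apply_zero_one_le (6 * k + 6) b c)
      (card_filter_apply_zero_one_le (6 * k + 6) y x)
    rw [← card_product, ← pow_add] at this
    rw [hn_def, show 12 * k + 12 = 6 * k + 6 + (6 * k + 6) by ring]
    exact_mod_cast this
  -- Fibre over the pair `(v, w)` and the last two vertices of both walks: `κ n^6` choices, each
  -- with `(δ n^(6k + 4))²` pairs of walks.
  have hdense : κ * δ ^ 2 * n ^ (12 * k + 12) * n ^ 2 ≤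
      #{q ∈ S ×ˢ (univ : Finset (V × V)) | r q.1 q.2} := by
    refine le_trans ?_ (card_mul_le_card_of_le_fiber _ K
      (fun q => (q.2, (q.1.1 ⟨6 * k + 6, by omega⟩, q.1.1 ⟨6 * k + 7, by omega⟩),
        (q.1.2 ⟨6 * k + 6, by omega⟩, q.1.2 ⟨6 * k + 7, by omega⟩)))
      ((δ * n ^ (6 * k + 4)) ^ 2) ?_)
    · calc _ = κ * n ^ 6 * (δ * n ^ (6 * k + 4)) ^ 2 := by ring
        _ ≤ _ := by gcongr
    · intro t ht
      have h4 := mul_le_mul (hqv t ht) (hqw t ht) (by positivity) (Nat.cast_nonneg _)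
      rw [← sq, ← Nat.cast_mul, ← card_product] at h4
      refine h4.trans (Nat.cast_le.2 (card_le_card_of_injOn (fun q => (q, t.1)) (fun q hq => ?_)
        fun x _ y _ hxy => congrArg Prod.fst hxy))
      obtain ⟨hq1, hq2⟩ := mem_product.1 (mem_coe.1 hq)
      obtain ⟨p0, p1, p2, p3⟩ := (mem_filter.1 hq1).2
      obtain ⟨q0, q1, q2, q3⟩ := (mem_filter.1 hq2).2
      refine mem_coe.2 (mem_filter.2 ⟨mem_filter.2 ⟨mem_product.2 ⟨mem_product.2
        ⟨mem_filter.2 ⟨mem_univ _, p0⟩, mem_filter.2 ⟨mem_univ _, q0⟩⟩, mem_univ _⟩,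
        (hr _ _).2 ⟨⟨hv t ht, hw t ht⟩, ⟨p3, q3⟩, ?_⟩⟩, ?_⟩)
      · rw [p1, p2, q1, q2]
        exact ⟨h1 t ht, h2 t ht, h3 t ht⟩
      · rw [p1, p2, q1, q2]
  have hblow := le_card_blowup S r (by positivity) (by positivity) (by positivity) hS hdense
    (2 * k + 2)
  have hpow : n ^ (16 * k + 18) = n ^ (12 * k + 12) * (n ^ 2) ^ (2 * k + 3) := by
    rw [← pow_mul, ← pow_add]
    congr 1
    ring
  rw [hpow, ← mul_assoc]
  refine hblow.trans (Nat.cast_le.2 ?_)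
  refine card_le_card_of_injOn
    (fun q (j : Fin (16 * k + 24)) => doubleWeave 3 (8 * k + 9 + 3) a z q.1.1 q.1.2 q.2 j) ?_ ?_
  · rintro ⟨⟨p, p'⟩, t⟩ hx
    obtain ⟨hxS, hr'⟩ := mem_filter.1 (mem_coe.1 hx)
    replace hr := fun t => (hr _ _).1 (hr' t)
    obtain ⟨hp, hp'⟩ := mem_product.1 (mem_product.1 hxS).1
    exact mem_coe.2 (mem_filter.2 ⟨mem_univ _,
      doubleWeave_three_tight (mem_filter.1 hp).2 (mem_filter.1 hp').2
      (fun t => (hr t).1.1) (fun t => (hr t).1.2) (fun t => (hr t).2.1.1) (fun t => (hr t).2.1.2)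
      (fun t => (hr t).2.2.1) (fun t => (hr t).2.2.2.1) (fun t => (hr t).2.2.2.2)⟩)
  · rintro ⟨⟨p, p'⟩, t⟩ - ⟨⟨q, q'⟩, t'⟩ - hxy
    obtain ⟨rfl, rfl, rfl⟩ := doubleWeave_injective (m := 2 * k + 2 + 1) (L := 8 * k + 9 + 3)
      (by omega) (by omega) (fun i hi => by omega) (fun j hj => congrFun hxy ⟨j, by omega⟩)
    rfl

/-! ### Dense graphs and robust subgraphs -/

open Finset Classical in
/-- Two relations whose supports have size at least `2n/3` and which satisfy suitable density
conditions have many common pairs. -/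
theorem le_card_common_pairs {V : Type*} [Fintype V] {A B : V → V → Prop} {X Y : Finset V} {α : ℝ}
    (hα : 0 ≤ α) (hA : ∀ x y, A x y → x ∈ X ∧ y ∈ X) (hB : ∀ x y, B x y → x ∈ Y ∧ y ∈ Y)
    (hX : (2 / 3 + α / 2) * (Fintype.card V : ℝ) ≤ #X)
    (hY : (2 / 3 + α / 2) * (Fintype.card V : ℝ) ≤ #Y)
    (hAc : (5 / 9 + α / 2) * (Fintype.card V : ℝ) ^ 2 - ((Fintype.card V : ℝ) - #X) ^ 2 ≤
      #{x : V × V | A x.1 x.2})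
    (hBc : (5 / 9 + α / 2) * (Fintype.card V : ℝ) ^ 2 - ((Fintype.card V : ℝ) - #Y) ^ 2 ≤
      #{x : V × V | B x.1 x.2}) :
    α * (Fintype.card V : ℝ) ^ 2 ≤ #{x : V × V | A x.1 x.2 ∧ B x.1 x.2} := by
  have h1 := card_union_add_card_inter ({x : V × V | A x.1 x.2} : Finset _)
    ({x : V × V | B x.1 x.2} : Finset _)
  rw [← filter_and] at h1
  have h2 : ({x : V × V | A x.1 x.2} : Finset _) ∪ ({x : V × V | B x.1 x.2} : Finset _) ⊆
      X ×ˢ X ∪ Y ×ˢ Y := by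
    intro x hx
    simp only [mem_union, mem_filter, mem_univ, true_and, mem_product] at hx ⊢
    exact hx.imp (hA _ _) (hB _ _)
  have h3 := card_union_add_card_inter (X ×ˢ X) (Y ×ˢ Y)
  have h4 : (X ×ˢ X) ∩ (Y ×ˢ Y) = (X ∩ Y) ×ˢ (X ∩ Y) := by
    ext
    simp only [mem_inter, mem_product]
    tauto
  have h5 := card_union_add_card_inter X Y
  have h6 : #(X ∪ Y) ≤ Fintype.card V := card_le_univ _
  have h7 : #X ≤ Fintype.card V := card_le_univ _
  have h8 : #Y ≤ Fintype.card V := card_le_univ _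
  replace h2 := card_le_card h2
  rw [h4] at h3
  simp only [card_product] at h3
  rify at h1 h2 h3 h5 h6 h7 h8
  set n : ℝ := (Fintype.card V : ℝ)
  have hn : 0 ≤ n := Nat.cast_nonneg _
  have hαn : 0 ≤ α * n := mul_nonneg hα hn
  have h9 : (#X + #Y - n : ℝ) ^ 2 ≤ (#(X ∩ Y) : ℝ) ^ 2 := by
    apply pow_le_pow_left₀ <;> linarith
  have h10 : (#X - #Y : ℝ) ^ 2 ≤ (n / 3) ^ 2 := by
    apply sq_le_sq' <;> linarith
  -- With `X`, `Y` standing for the sizes, `(n - X)² + (n - Y)² + X² + Y² - (X + Y - n)² = n² + (X -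
  -- Y)²`. Inclusion–exclusion thus leaves at least `(1/9 + α) n² - (X - Y)²` common pairs, and `|X
  -- - Y| ≤ n / 3`.
  nlinarith

open Finset in
theorem card_pairs_le_mul {V : Type*} [Fintype V] {ω : Type*} [Fintype ω] (P : V → ω → Prop)
    [∀ x y, Decidable (P x y)] {t : ℝ} (h : ∀ x, (#{y | P x y} : ℝ) ≤ t) :
    (#{x : V × ω | P x.1 x.2} : ℝ) ≤ Fintype.card V * t := by
  have : (#{x : V × ω | P x.1 x.2} : ℝ) = ∑ x, (#{y | P x y} : ℝ) := by
    simp only [card_filter, ← univ_product_univ, sum_product]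
    push_cast
    rfl
  rw [this, ← nsmul_eq_mul]
  exact sum_le_card_nsmul _ _ _ fun x _ => h x

open Finset Classical in
/-- A dense graph has many walks `x y y' x'`. -/
theorem le_card_walks_three {V : Type*} [Fintype V] {D : V → V → Prop}
    (hD : ∀ x y, D x y → D y x) {d : ℝ} (hd : 0 ≤ d)
    (h : d * (Fintype.card V : ℝ) ^ 2 ≤ #{x : V × V | D x.1 x.2}) :
    d ^ 3 / 32 * (Fintype.card V : ℝ) ^ 4 ≤
      #{t : (V × V) × (V × V) | D t.1.1 t.1.2 ∧ D t.1.2 t.2.2 ∧ D t.2.1 t.2.2} := by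
  set n : ℝ := (Fintype.card V : ℝ)
  -- Discarding pairs that meet a vertex of degree below `d n / 4` keeps at least half of them. Each
  -- remaining pair, taken as the middle `y y'`, extends in `(d n / 4)²` ways, and `d/2 * (d/4)² =
  -- d³/32`.
  set big : V → Prop := fun x => d / 4 * n ≤ #{y | D y x}
  have hlow : (#{x : V × V | D x.2 x.1 ∧ ¬ big x.1} : ℝ) ≤ n * (d / 4 * n) := by
    refine card_pairs_le_mul (fun x y => D y x ∧ ¬ big x) fun x => ?_
    by_cases hx : big x
    · simp only [hx, not_true, and_false, filter_false, card_empty, Nat.cast_zero]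
      positivity
    · simp only [hx, not_false_eq_true, and_true]
      exact (not_le.1 hx).le
  have hlow' : #{x : V × V | D x.1 x.2 ∧ ¬ big x.2} ≤ #{x : V × V | D x.2 x.1 ∧ ¬ big x.1} :=
    card_le_card_of_injOn Prod.swap (fun x hx => by simpa using hx) Prod.swap_injective.injOn
  have hK : d / 2 * n ^ 2 ≤ #{x : V × V | D x.1 x.2 ∧ big x.1 ∧ big x.2} := by
    have hsub : ({x : V × V | D x.1 x.2} : Finset _) ⊆
        ({x : V × V | D x.1 x.2 ∧ big x.1 ∧ big x.2} : Finset _) ∪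
        (({x : V × V | D x.2 x.1 ∧ ¬ big x.1} : Finset _) ∪
          ({x : V × V | D x.1 x.2 ∧ ¬ big x.2} : Finset _)) := by
      intro x hx
      simp only [mem_filter, mem_univ, true_and, mem_union] at hx ⊢
      have := hD _ _ hx
      tauto
    have h1 := (card_le_card hsub).trans ((card_union_le _ _).trans
      (Nat.add_le_add_left (card_union_le _ _) _))
    rify at h1 hlow'
    linarith
  refine le_trans ?_ (card_mul_le_card_of_le_fiber _
    ({x : V × V | D x.1 x.2 ∧ big x.1 ∧ big x.2} : Finset _) (fun t => (t.1.2, t.2.2))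
    ((d / 4 * n) ^ 2) ?_)
  · calc _ = d / 2 * n ^ 2 * (d / 4 * n) ^ 2 := by ring
      _ ≤ _ := by gcongr
  · rintro ⟨y, y'⟩ hy
    obtain ⟨hyy, hy, hy'⟩ := (mem_filter.1 hy).2
    have h4 := mul_le_mul hy hy' (by positivity) (Nat.cast_nonneg _)
    rw [← sq, ← Nat.cast_mul, ← card_product] at h4
    refine h4.trans (Nat.cast_le.2 (card_le_card_of_injOn (fun x => ((x.1, y), (x.2, y')))
      (fun x hx => ?_) fun x _ x' _ hxx => ?_))
    · simp only [mem_coe, mem_product, mem_filter, mem_univ, true_and] at hx ⊢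
      exact ⟨⟨hx.1, hyy, hx.2⟩, trivial⟩
    · simp only [Prod.mk.injEq, and_true] at hxx
      exact Prod.ext hxx.1 hxx.2

open Finset Classical in
/-- If the elements outside `C` are related to at most `t` elements of `V`, then few elements of
`V` are related to more than `s` elements outside `C`. -/
theorem card_mul_le_of_codegree_le {V ω : Type*} [Fintype V] [Fintype ω] (S : V → ω → Prop)
    (C : ω → Prop) {s t : ℝ} (ht : 0 ≤ t) (hC : ∀ x, ¬ C x → (#{u | S u x} : ℝ) ≤ t) :
    (#{w | s < #{x | S w x ∧ ¬ C x}} : ℝ) * s ≤ Fintype.card ω * t := by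
  have h1 : (#{p : ω × V | S p.2 p.1 ∧ ¬ C p.1} : ℝ) ≤ Fintype.card ω * t := by
    refine card_pairs_le_mul (fun x w => S w x ∧ ¬ C x) fun x => ?_
    by_cases hx : C x
    · simpa [hx] using ht
    · simpa [hx] using hC x hx
  refine (card_mul_le_card_of_le_fiber _ _ (fun p => p.2) s fun w hw => ?_).trans h1
  refine (mem_filter.1 hw).2.le.trans (Nat.cast_le.2 (card_le_card_of_injOn (fun x => (x, w))
    (fun x hx => ?_) fun x _ y _ hxy => congrArg Prod.fst hxy))
  simpa using hx

open Finset Classical in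
/-- Many walks `x y y' x'` in the graphs `T v w`, whose end edges are connectable for `v` and `w`,
respectively. -/
theorem le_card_connecting_walks {V : Type*} [Fintype V] {T : V → V → V → V → Prop}
    (hT : ∀ v w x y, T v w x y → T w v x y) (hT' : ∀ v w x y, T v w x y → T v w y x)
    (hE : ∀ v w, v ≠ w → 4 / 9 * (Fintype.card V : ℝ) ^ 2 ≤ #{x : V × V | T v w x.1 x.2})
    {A B : Finset V} {ζ : ℝ} (hζ : 0 < ζ) (hA : ζ * Fintype.card V ≤ #A)
    (hB : ζ * Fintype.card V ≤ #B) (hn : 4 ≤ ζ ^ 2 * Fintype.card V) :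
    ζ ^ 2 / 2 * ((2 / 9) ^ 3 / 32) * (Fintype.card V : ℝ) ^ 6 ≤
      #{t : (V × V) × (V × V) × (V × V) | (t.1.1 ∈ A ∧ t.1.2 ∈ B) ∧
        (ζ ^ 2 / 72 * Fintype.card V ≤ #{u | T u t.1.1 t.2.1.1 t.2.1.2} ∧
          ζ ^ 2 / 72 * Fintype.card V ≤ #{u | T u t.1.2 t.2.2.1 t.2.2.2}) ∧
        T t.1.1 t.1.2 t.2.1.1 t.2.1.2 ∧ T t.1.1 t.1.2 t.2.1.2 t.2.2.2 ∧
        T t.1.1 t.1.2 t.2.2.1 t.2.2.2} := by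
  set n : ℝ := (Fintype.card V : ℝ) with hn_def
  have hn0 : 0 ≤ n := Nat.cast_nonneg _
  -- The threshold `ζ² / 72` makes bad pairs rare: by double counting each `v` has at most `9 *
  -- ζ²/72 * n = ζ² n / 8` bad partners `w`.
  set C : V → V × V → Prop := fun v x => ζ ^ 2 / 72 * n ≤ #{u | T u v x.1 x.2}
  set bad : V → V → Prop := fun v w => n ^ 2 / 9 < #{x : V × V | T w v x.1 x.2 ∧ ¬ C v x}
  have hn1 : 0 < n := by
    refine hn0.lt_of_ne fun h => ?_
    rw [← h] at hn
    norm_num at hn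
  have hbad (v : V) : (#{w | bad v w} : ℝ) ≤ 9 * (ζ ^ 2 / 72) * n := by
    have h1 := card_mul_le_of_codegree_le (fun w (x : V × V) => T w v x.1 x.2) (C v)
      (s := n ^ 2 / 9) (t := ζ ^ 2 / 72 * n) (by positivity) fun x hx => (not_le.1 hx).le
    rw [Fintype.card_prod, Nat.cast_mul, ← hn_def] at h1
    refine le_of_mul_le_mul_right (h1.trans (le_of_eq ?_)) (by positivity : 0 < n ^ 2 / 9)
    ring
  have hbad1 : (#{p : V × V | bad p.1 p.2} : ℝ) ≤ n * (9 * (ζ ^ 2 / 72) * n) :=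
    card_pairs_le_mul bad hbad
  have hbad2 : #{p : V × V | bad p.2 p.1} ≤ #{p : V × V | bad p.1 p.2} :=
    card_le_card_of_injOn Prod.swap (fun x hx => by simpa using hx) Prod.swap_injective.injOn
  have hdiag : #{p : V × V | p.1 = p.2} ≤ Fintype.card V := by
    rw [← card_univ]
    refine card_le_card_of_injOn Prod.fst (fun _ _ => mem_coe.2 (mem_univ _)) fun p hp q hq hpq => ?_
    have hp := (mem_filter.1 (mem_coe.1 hp)).2
    have hq := (mem_filter.1 (mem_coe.1 hq)).2
    exact Prod.ext hpq (by rw [← hp, ← hq, hpq])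
  -- Bad pairs in the two orders cost `ζ² n² / 4` together, and the diagonal costs `n ≤ ζ² n² / 4`.
  have hQ : ζ ^ 2 / 2 * n ^ 2 ≤
      #{p ∈ A ×ˢ B | p.1 ≠ p.2 ∧ ¬ bad p.1 p.2 ∧ ¬ bad p.2 p.1} := by
    have hsub : A ×ˢ B ⊆ ({p ∈ A ×ˢ B | p.1 ≠ p.2 ∧ ¬ bad p.1 p.2 ∧ ¬ bad p.2 p.1} : Finset _) ∪
        (({p : V × V | p.1 = p.2} : Finset _) ∪
        (({p : V × V | bad p.1 p.2} : Finset _) ∪ ({p : V × V | bad p.2 p.1} : Finset _))) := by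
      intro p hp
      simp only [mem_filter, mem_univ, true_and, mem_union, hp]
      tauto
    have h1 := (card_le_card hsub).trans ((card_union_le _ _).trans (Nat.add_le_add_left
      ((card_union_le _ _).trans (Nat.add_le_add_left (card_union_le _ _) _)) _))
    rw [card_product] at h1
    rify at h1 hbad2 hdiag
    rw [← hn_def] at hdiag
    have h2 := mul_le_mul hA hB (by positivity) (Nat.cast_nonneg _)
    nlinarith
  refine le_trans ?_ (card_mul_le_card_of_le_fiber _
    ({p ∈ A ×ˢ B | p.1 ≠ p.2 ∧ ¬ bad p.1 p.2 ∧ ¬ bad p.2 p.1} : Finset _) (fun t => t.1)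
    ((2 / 9) ^ 3 / 32 * n ^ 4) ?_)
  · calc _ = ζ ^ 2 / 2 * n ^ 2 * ((2 / 9) ^ 3 / 32 * n ^ 4) := by ring
      _ ≤ _ := by gcongr
  · rintro ⟨v, w⟩ hp
    obtain ⟨hAB, hvw, hb1, hb2⟩ := mem_filter.1 hp
    obtain ⟨hvA, hwB⟩ := mem_product.1 hAB
    have hCs (v x y) (h : C v (x, y)) : C v (y, x) := by
      refine h.trans (Nat.cast_le.2 (card_le_card fun u hu => ?_))
      simp only [mem_filter, mem_univ, true_and] at hu ⊢
      exact hT' _ _ _ _ hu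
    obtain ⟨D, hD⟩ : ∃ D : V → V → Prop,
        ∀ x y, D x y ↔ T v w x y ∧ C v (x, y) ∧ C w (x, y) := ⟨_, fun _ _ => Iff.rfl⟩
    -- For a good pair, `4/9 - 1/9 - 1/9 = 2/9`.
    have hdense : 2 / 9 * n ^ 2 ≤ #{x : V × V | D x.1 x.2} := by
      have hsub : ({x : V × V | T v w x.1 x.2} : Finset _) ⊆
          ({x : V × V | D x.1 x.2} : Finset _) ∪
          (({x : V × V | T w v x.1 x.2 ∧ ¬ C v x} : Finset _) ∪
            ({x : V × V | T v w x.1 x.2 ∧ ¬ C w x} : Finset _)) := by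
        intro x hx
        simp only [mem_filter, mem_univ, true_and, mem_union, hD] at hx ⊢
        have := hT _ _ _ _ hx
        tauto
      have h1 := (card_le_card hsub).trans ((card_union_le _ _).trans
        (Nat.add_le_add_left (card_union_le _ _) _))
      have h2 := not_lt.1 hb1
      have h3 := not_lt.1 hb2
      have h4 := hE v w hvw
      rify at h1
      linarith
    have hDs (x y) (h : D x y) : D y x := by
      rw [hD] at h ⊢
      exact ⟨hT' _ _ _ _ h.1, hCs _ _ _ h.2.1, hCs _ _ _ h.2.2⟩
    refine (le_card_walks_three hDs (by norm_num) hdense).trans (Nat.cast_le.2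
      (card_le_card_of_injOn (fun x => ((v, w), x)) (fun x hx => ?_)
        fun x _ y _ hxy => congrArg Prod.snd hxy))
    have h := (mem_filter.1 (mem_coe.1 hx)).2
    simp only [hD] at h
    obtain ⟨d1, d2, d3⟩ := h
    exact mem_coe.2 (mem_filter.2 ⟨mem_filter.2 ⟨mem_univ _, ⟨hvA, hwB⟩, ⟨d1.2.1, d3.2.2⟩,
      d1.1, d2.1, d3.1⟩, rfl⟩)

open Finset Classical in
/-- The paths of a robust subgraph, as sequences of vertices. -/
theorem SimpleGraph.Subgraph.le_card_walks_of_isRobust {V : Type*} [Fintype V] {G : SimpleGraph V}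
    {R : G.Subgraph} {β : ℝ} {l : ℕ} (hR : R.coe.IsRobust β (l + 1)) {x y : V} (hx : x ∈ R.verts)
    (hy : y ∈ R.verts) (hxy : x ≠ y) :
    β * (R.verts.ncard : ℝ) ^ l ≤ #{p : Fin (l + 2) → V | p 0 = x ∧ p (Fin.last _) = y ∧
      ∀ i : Fin (l + 1), R.Adj (p i.castSucc) (p i.succ)} := by
  have h := hR ⟨x, hx⟩ ⟨y, hy⟩ (fun h => hxy (congrArg Subtype.val h))
  rw [Nat.add_sub_cancel] at h
  refine h.trans (Nat.cast_le.2 ?_)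
  rw [← Set.ncard_coe_finset]
  refine Set.ncard_le_ncard_of_injOn (fun p i => (p.getVert i : V)) ?_ ?_
  · rintro p ⟨-, hp⟩
    simp only [mem_coe, mem_filter, mem_univ, true_and]
    refine ⟨by simp, ?_, fun i => ?_⟩
    · rw [Fin.val_last, ← hp, SimpleGraph.Walk.getVert_length]
    · exact p.adj_getVert_succ (i.2.trans_eq hp.symm)
  · rintro p ⟨-, hp⟩ q ⟨-, hq⟩ hpq
    refine SimpleGraph.Walk.ext_getVert_le_length (hp.trans hq.symm) fun i hi => ?_
    exact Subtype.ext (congrFun hpq ⟨i, by omega⟩)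

open Finset Classical in
theorem SimpleGraph.Subgraph.two_mul_ncard_edgeSet {V : Type*} [Fintype V] {G : SimpleGraph V}
    (R : G.Subgraph) : 2 * R.edgeSet.ncard = #{x : V × V | R.Adj x.1 x.2} := by
  have := R.spanningCoe.two_mul_card_edgeFinset
  rw [← SimpleGraph.Subgraph.edgeSet_spanningCoe, ← SimpleGraph.coe_edgeFinset,
    Set.ncard_coe_finset]
  exact this

/-! ### The connecting lemma -/

open Finset Classical in
theorem SimpleGraph.Subgraph.IsRobustPart.le_card_adj {V : Type*} [Fintype V] {G : SimpleGraph V}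
    {R : G.Subgraph} {α μ β : ℝ} {ℓ : ℕ} (hR : R.IsRobustPart α μ β ℓ) :
    (5 / 9 + α / 2) * (Fintype.card V : ℝ) ^ 2 - ((Fintype.card V : ℝ) - R.verts.ncard) ^ 2 ≤
      #{x : V × V | R.Adj x.1 x.2} := by
  have h1 := hR.card_edges
  rw [Nat.card_eq_fintype_card] at h1
  have h2 := R.two_mul_ncard_edgeSet
  rify at h2
  linarith

-- These common edges join the ends of two walks that live in different link graphs.
open Finset Classical in
theorem SimpleGraph.Subgraph.IsRobustPart.le_card_common_adj {V : Type*} [Fintype V]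
    {G G' : SimpleGraph V} {R : G.Subgraph} {R' : G'.Subgraph} {α μ β : ℝ} {ℓ : ℕ} (hα : 0 ≤ α)
    (hR : R.IsRobustPart α μ β ℓ) (hR' : R'.IsRobustPart α μ β ℓ) :
    α * (Fintype.card V : ℝ) ^ 2 ≤ #{x : V × V | R.Adj x.1 x.2 ∧ R'.Adj x.1 x.2} := by
  have h1 := hR.le_card_adj
  have h2 := hR'.le_card_adj
  have h3 := hR.card_verts
  have h4 := hR'.card_verts
  rw [Set.ncard_eq_toFinset_card'] at h1 h2 h3 h4
  rw [Nat.card_eq_fintype_card] at h3 h4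
  exact le_card_common_pairs hα
    (fun x y h => ⟨Set.mem_toFinset.2 (R.edge_vert h), Set.mem_toFinset.2 (R.edge_vert h.symm)⟩)
    (fun x y h => ⟨Set.mem_toFinset.2 (R'.edge_vert h), Set.mem_toFinset.2 (R'.edge_vert h.symm)⟩)
    h3 h4 h1 h2

theorem Hypergraph.pairLink_adj_iff {V : Type*} {H : Hypergraph V} {u v x y : V} :
    (H.pairLink s(u, v)).Adj x y ↔ x ≠ y ∧ ({u, v, x, y} : Set V) ∈ H.edgeSet := by
  have : ((s(u, v) : Sym2 V) : Set V) ∪ {x, y} = {u, v, x, y} := by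
    ext
    simp
    tauto
  rw [← this]
  rfl

open Finset Classical in
/-- Many tight walks in the link of `v` between two connectable pairs. -/
theorem Hypergraph.le_card_link_tight_walks {V : Type*} [Fintype V] {H : Hypergraph V}
    {R : ∀ uv : Sym2 V, (H.pairLink uv).Subgraph} {α μ β η : ℝ} (k : ℕ) (hα : 0 ≤ α) (hβ : 0 ≤ β)
    (hη : 0 ≤ η)
    (hR : ∀ uv : Sym2 V, ¬ uv.IsDiag → (R uv).IsRobustPart α μ β (2 * k + 1))
    (hn : 4 ≤ α * Fintype.card V) (v b c d e : V)
    (hbc : η * Fintype.card V ≤ #{u | u ≠ v ∧ (R s(u, v)).Adj b c})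
    (hde : η * Fintype.card V ≤ #{u | u ≠ v ∧ (R s(u, v)).Adj d e}) :
    (η ^ 2 * (α / 2) * (β * (2 / 3) ^ (2 * k)) ^ 2) ^ (k + 1) *
        (Fintype.card V : ℝ) ^ (6 * k + 4) ≤
      #{q : Fin (6 * k + 6 + 2) → V | (q 0 = b ∧ q 1 = c) ∧ q ⟨6 * k + 6, by omega⟩ = d ∧
        q ⟨6 * k + 7, by omega⟩ = e ∧ ∀ (i : ℕ) (hi : i + 2 < 6 * k + 8),
          ({v, q ⟨i, by omega⟩, q ⟨i + 1, by omega⟩, q ⟨i + 2, hi⟩} : Set V) ∈ H.edgeSet} := by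
  have hdiag {u : V} (hu : u ∈ univ.erase v) : ¬ (s(u, v) : Sym2 V).IsDiag := by
    simpa using hu
  refine (le_card_tight_walks (𝓔 := {f | insert v f ∈ H.edgeSet})
    (fun u x y => (R s(u, v)).Adj x y) (fun u x y h => ?_) (univ.erase v) k
    (by positivity) hα hη (fun u hu x y hx hy hxy => ?_) (fun u hu u' hu' => ?_) hn b c d e
    (hbc.trans ?_) (hde.trans ?_)).trans ?_
  · have := (Hypergraph.pairLink_adj_iff.1 h.adj_sub).2
    rwa [Set.insert_comm] at this
  · have h1 := hR _ (hdiag hu)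
    obtain ⟨x', hx⟩ := hx
    obtain ⟨y', hy⟩ := hy
    refine le_trans ?_ (SimpleGraph.Subgraph.le_card_walks_of_isRobust h1.robust
      ((R _).edge_vert hx) ((R _).edge_vert hy) hxy)
    -- Robustness counts in powers of `|V(R)| ≥ 2n/3`, whence the factor `(2/3) ^ (2 * k)`.
    rw [mul_assoc, ← mul_pow]
    have h2 := h1.card_verts
    rw [Nat.card_eq_fintype_card] at h2
    have h3 : 0 ≤ α * Fintype.card V := by linarith
    gcongr
    linarith
  · refine ((hR _ (hdiag hu)).le_card_common_adj hα (hR _ (hdiag hu'))).trans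
      (Nat.cast_le.2 (card_le_card fun x hx => ?_))
    simp only [mem_filter, mem_univ, true_and] at hx ⊢
    exact ⟨hx.1, hx.2.symm⟩
  · refine Nat.cast_le.2 (card_le_card fun u hu => ?_)
    simp only [mem_filter, mem_univ, true_and, mem_erase, and_true] at hu ⊢
    exact ⟨hu.1, hu.2, _, hu.2.symm⟩
  · refine Nat.cast_le.2 (card_le_card fun u hu => ?_)
    simp only [mem_filter, mem_univ, true_and, mem_erase, and_true] at hu ⊢
    exact ⟨hu.1, hu.2.symm, _, hu.2⟩
  · refine Nat.cast_le.2 (card_le_card fun q hq => ?_)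
    exact mem_filter.2 ⟨mem_univ _, (mem_filter.1 hq).2⟩

-- Connectability in the link of `v` is measured against `n - 1 ≥ n / 2` vertices, so halving `ζ`
-- allows all counts to be relative to `n`.
open Finset Classical in
theorem Hypergraph.IsConnectableTriple.le_card {V : Type*} [Fintype V] {H : Hypergraph V}
    {R : ∀ uv : Sym2 V, (H.pairLink uv).Subgraph} {ζ : ℝ} {x y z : V}
    (h : H.IsConnectableTriple R ζ x y z) (hH : H.vertexSet = Set.univ) (hζ : 0 ≤ ζ)
    (hn : 2 ≤ Fintype.card V) :
    ζ * Fintype.card V ≤ #{v | ({v, x, y, z} : Set V) ∈ H.edgeSet ∧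
      ζ / 2 * Fintype.card V ≤ #{u | u ≠ v ∧ (R s(u, v)).Adj x y} ∧
      ζ / 2 * Fintype.card V ≤ #{u | u ≠ v ∧ (R s(u, v)).Adj y z}} := by
  have key {v p q : V} (h : ((H.link v).deleteVertex v).IsConnectablePair
      (fun u => (R s(u, v)).spanningCoe) ζ p q) :
      ζ / 2 * Fintype.card V ≤ #{u | u ≠ v ∧ (R s(u, v)).Adj p q} := by
    have h1 := h.2.2.2
    have h2 : ((H.link v).deleteVertex v).vertexSet = {v}ᶜ := by
      change H.vertexSet \ {v} = _
      rw [hH, Set.compl_eq_univ_sdiff]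
    have h3 : (({v}ᶜ : Set V).ncard : ℝ) = Fintype.card V - 1 := by
      rw [Set.ncard_compl, Set.ncard_singleton, Nat.card_eq_fintype_card,
        Nat.cast_sub (by omega), Nat.cast_one]
    rw [h2, h3] at h1
    rw [← Set.ncard_coe_finset, coe_filter]
    have h4 : (2 : ℝ) ≤ Fintype.card V := by exact_mod_cast hn
    refine le_trans ?_ (h1.trans (le_of_eq ?_))
    · nlinarith
    · congr 2
      ext u
      simp
  unfold Hypergraph.IsConnectableTriple at h
  rw [hH, Set.ncard_univ, Nat.card_eq_fintype_card] at h
  refine h.trans ?_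
  rw [← Set.ncard_coe_finset]
  refine Nat.cast_le.2 (Set.ncard_le_ncard (fun v hv => ?_) (Set.toFinite _))
  obtain ⟨-, he, h1, h2⟩ := hv
  exact mem_coe.2 (mem_filter.2 ⟨mem_univ _, he.1.2, key h1, key h2⟩)

theorem Set.ne_of_encard_eq_four {V : Type*} {v x y z : V}
    (h : ({v, x, y, z} : Set V).encard = 4) : x ≠ y ∧ x ≠ z ∧ y ≠ z := by
  have h3 (p q r : V) : ({p, q, r} : Set V).encard ≠ 4 := by
    have h1 := (Set.encard_insert_le {q, r} p).trans
      (add_le_add_left (Set.encard_insert_le {r} q) 1)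
    rw [Set.encard_singleton] at h1
    intro h4
    rw [h4] at h1
    norm_num at h1
  refine ⟨?_, ?_, ?_⟩ <;> rintro rfl
  · exact h3 v x z (by convert h using 2; ext; simp)
  · exact h3 v x y (by convert h using 2; ext; simp; tauto)
  · exact h3 v x y (by convert h using 2; ext; simp)

open Finset Classical in
/-- Almost all tight walks between two disjoint triples are tight paths. -/
theorem Hypergraph.le_ncard_tightPaths {V : Type*} [Fintype V] (H : Hypergraph V) (m : ℕ)
    {a b c x y z : V} (habc : a ≠ b ∧ a ≠ c ∧ b ≠ c) (hxyz : x ≠ y ∧ x ≠ z ∧ y ≠ z)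
    (hdisj : Disjoint ({a, b, c} : Set V) {x, y, z}) {C : ℝ}
    (hn : 2 * ((m + 7 : ℕ) : ℝ) ^ 2 ≤ C * Fintype.card V)
    (h : C * (Fintype.card V : ℝ) ^ (m + 1) ≤
      #{p : Fin (m + 7) → V | (p ⟨0, by omega⟩ = a ∧ p ⟨1, by omega⟩ = b ∧
        p ⟨2, by omega⟩ = c ∧ p ⟨m + 4, by omega⟩ = x ∧ p ⟨m + 5, by omega⟩ = y ∧
        p ⟨m + 6, by omega⟩ = z) ∧ ∀ (i : ℕ) (hi : i + 3 < m + 7),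
          ({p ⟨i, by omega⟩, p ⟨i + 1, by omega⟩, p ⟨i + 2, by omega⟩, p ⟨i + 3, hi⟩} : Set V)
            ∈ H.edgeSet}) :
    C / 2 * (Fintype.card V : ℝ) ^ (m + 1) ≤ ((H.tightPaths (m + 1) a b c x y z).ncard : ℝ) := by
  set n : ℝ := (Fintype.card V : ℝ) with hn_def
  set W : Finset (Fin (m + 7) → V) := {p : Fin (m + 7) → V | (p ⟨0, by omega⟩ = a ∧
    p ⟨1, by omega⟩ = b ∧ p ⟨2, by omega⟩ = c ∧ p ⟨m + 4, by omega⟩ = x ∧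
    p ⟨m + 5, by omega⟩ = y ∧ p ⟨m + 6, by omega⟩ = z) ∧ ∀ (i : ℕ) (hi : i + 3 < m + 7),
      ({p ⟨i, by omega⟩, p ⟨i + 1, by omega⟩, p ⟨i + 2, by omega⟩, p ⟨i + 3, hi⟩} : Set V)
        ∈ H.edgeSet} with hW
  have hpath : H.tightPaths (m + 1) a b c x y z = (({p ∈ W | Function.Injective p} : Finset _) :
      Set (Fin (m + 7) → V)) := by
    ext p
    rw [mem_coe, mem_filter, hW, mem_filter]
    constructor
    · rintro ⟨⟨h1, h2⟩, h3⟩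
      exact ⟨⟨mem_univ _, h3, h2⟩, h1⟩
    · rintro ⟨⟨-, h3, h2⟩, h1⟩
      exact ⟨⟨h1, h2⟩, h3⟩
  rw [hpath, Set.ncard_coe_finset]
  have hsplit := card_filter_add_card_filter_not (s := W) (fun p => Function.Injective p)
  have hbad : #{p ∈ W | ¬ Function.Injective p} ≤ (m + 7) ^ 2 * Fintype.card V ^ m := by
    -- Any element of `W` serves as the function `g` prescribing the six end values.
    rcases W.eq_empty_or_nonempty with hE | ⟨g, hg⟩
    · simp [hE]
    set E : Finset (Fin (m + 7)) := {⟨0, by omega⟩, ⟨1, by omega⟩, ⟨2, by omega⟩,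
      ⟨m + 4, by omega⟩, ⟨m + 5, by omega⟩, ⟨m + 6, by omega⟩} with hE
    have hEc : #E = 6 := by
      simp [hE, Fin.ext_iff]
    have hgW := (mem_filter.1 hg).2.1
    have hinj : Set.InjOn g E := by
      obtain ⟨g0, g1, g2, g3, g4, g5⟩ := hgW
      simp only [Set.disjoint_left, Set.mem_insert_iff, Set.mem_singleton_iff, forall_eq_or_imp,
        forall_eq, not_or] at hdisj
      intro i hi j hj hij
      simp only [hE, coe_insert, coe_singleton, Set.mem_insert_iff, Set.mem_singleton_iff] at hi hj
      rcases hi with rfl | rfl | rfl | rfl | rfl | rfl <;>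
      rcases hj with rfl | rfl | rfl | rfl | rfl | rfl <;>
      first | rfl | (simp only [g0, g1, g2, g3, g4, g5] at hij; grind)
    refine (card_not_injective_le E g hinj _ fun p hp => ?_).trans ?_
    · obtain ⟨hpW, hp⟩ := mem_filter.1 hp
      have hpW := (mem_filter.1 hpW).2.1
      refine ⟨fun i hi => ?_, hp⟩
      simp only [hE, mem_insert, mem_singleton] at hi
      rcases hi with rfl | rfl | rfl | rfl | rfl | rfl
      · rw [hpW.1, hgW.1]
      · rw [hpW.2.1, hgW.2.1]
      · rw [hpW.2.2.1, hgW.2.2.1]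
      · rw [hpW.2.2.2.1, hgW.2.2.2.1]
      · rw [hpW.2.2.2.2.1, hgW.2.2.2.2.1]
      · rw [hpW.2.2.2.2.2, hgW.2.2.2.2.2]
    · rw [hEc, Fintype.card_fin]
      exact le_of_eq (by congr 2)
  have h1 : (#{p ∈ W | ¬ Function.Injective p} : ℝ) ≤ ((m + 7 : ℕ) : ℝ) ^ 2 * n ^ m := by
    rw [hn_def]
    exact_mod_cast hbad
  have h2 : (#{p ∈ W | Function.Injective p} : ℝ) + #{p ∈ W | ¬ Function.Injective p} = #W := by
    exact_mod_cast hsplit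
  -- By the choice of threshold the non-injective walks are at most half of the guaranteed number.
  have h3 := mul_le_mul_of_nonneg_right hn (by positivity : 0 ≤ n ^ m)
  have h4 : n ^ (m + 1) = n * n ^ m := pow_succ' _ _
  rw [h4] at h ⊢
  nlinarith

theorem mainTheorem2 (α β ζ : ℝ) (ℓ : ℕ) (hα_pos : 0 < α) (hα_lt : α < 1 / 3) (hβ : 0 < β)
    (hζ : 0 < ζ) (hℓ : 3 ≤ ℓ) (hℓ_odd : Odd ℓ) :
    ∃ θ : ℝ, 0 < θ ∧ ∃ n₀ : ℕ,
      ∀ (V : Type*) [Finite V] (H : Hypergraph V),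
        H.vertexSet = Set.univ → H.IsUniform 4 → n₀ ≤ Nat.card V →
        (5 / 9 + α) * (Nat.card V : ℝ) ^ 2 / 2 ≤ (H.minDegree 2 : ℝ) →
        ∀ R : ∀ uv : Sym2 V, (H.pairLink uv).Subgraph,
          (∀ uv : Sym2 V, ¬ uv.IsDiag → (R uv).IsRobustPart α (α ^ 3 / 18) β ℓ) →
          ∀ a b c x y z : V,
            Disjoint ({a, b, c} : Set V) {x, y, z} →
            H.IsConnectableTriple R ζ a b c →
            H.IsConnectableTriple R ζ x y z →
            θ * (Nat.card V : ℝ) ^ (8 * ℓ + 10) ≤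
              ((H.tightPaths (8 * ℓ + 10) a b c x y z).ncard : ℝ) := by
  classical
  obtain ⟨k, rfl⟩ := hℓ_odd
  have hm : 8 * (2 * k + 1) + 10 = 16 * k + 17 + 1 := by ring
  rw [hm]
  -- A common connectability level: `ζ / 2` for the given end pairs, `ζ² / 72` for the pairs found
  -- by averaging.
  set η : ℝ := min (ζ / 2) (ζ ^ 2 / 72)
  have hη : 0 < η := by positivity
  set δ : ℝ := (η ^ 2 * (α / 2) * (β * (2 / 3) ^ (2 * k)) ^ 2) ^ (k + 1)
  have hδ : 0 < δ := by positivity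
  set κ : ℝ := ζ ^ 2 / 2 * ((2 / 9) ^ 3 / 32)
  have hκ : 0 < κ := by positivity
  set C : ℝ := (κ * δ ^ 2) ^ (2 * k + 3)
  have hC : 0 < C := by positivity
  -- Half of `C` is lost to non-injective walks. The summands of the threshold give `2 ≤ n`, `4 ≤ α
  -- n`, `4 ≤ ζ² n` and the bound needed for that loss.
  refine ⟨C / 2, by positivity,
    ⌈2 + 4 / α + 4 / ζ ^ 2 + 2 * ((16 * k + 17 + 7 : ℕ) : ℝ) ^ 2 / C⌉₊, ?_⟩
  intro V _ H hV hH hn _ R hR a b c x y z hdisj habc hxyz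
  have := Fintype.ofFinite V
  rw [Nat.card_eq_fintype_card] at hn ⊢
  replace hn := (Nat.le_ceil _).trans (Nat.cast_le (α := ℝ).2 hn)
  have q1 : 0 ≤ 4 / α := by positivity
  have q2 : 0 ≤ 4 / ζ ^ 2 := by positivity
  have q3 : 0 ≤ 2 * ((16 * k + 17 + 7 : ℕ) : ℝ) ^ 2 / C := by positivity
  have hn2 : 2 ≤ Fintype.card V := by
    have : (2 : ℝ) ≤ Fintype.card V := by linarith
    exact_mod_cast this
  have hnα : 4 ≤ α * Fintype.card V := by
    rw [← div_le_iff₀' hα_pos]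
    linarith
  have hnζ : 4 ≤ ζ ^ 2 * Fintype.card V := by
    rw [← div_le_iff₀' (by positivity)]
    linarith
  have hnC : 2 * ((16 * k + 17 + 7 : ℕ) : ℝ) ^ 2 ≤ C * Fintype.card V := by
    rw [← div_le_iff₀' hC]
    linarith
  -- As `ζ > 0`, some `v` completes the triple to an edge, which has four elements.
  have hdistinct {x y z : V} (h : H.IsConnectableTriple R ζ x y z) : x ≠ y ∧ x ≠ z ∧ y ≠ z := by
    have h1 := h.le_card hV hζ.le hn2
    have h2 : (0 : ℝ) < Fintype.card V := by exact_mod_cast (by omega : 0 < Fintype.card V)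
    obtain ⟨v, hv⟩ := Finset.card_pos.1 (Nat.cast_pos.1 ((mul_pos hζ h2).trans_le h1))
    exact Set.ne_of_encard_eq_four (hH _ (Finset.mem_filter.1 hv).2.1)
  obtain ⟨T, hT⟩ : ∃ T : V → V → V → V → Prop,
      ∀ v w x y, T v w x y ↔ v ≠ w ∧ (R s(v, w)).Adj x y := ⟨_, fun _ _ _ _ => Iff.rfl⟩
  have hTs (v w x y : V) (h : T v w x y) : T w v x y := by
    rw [hT] at h ⊢
    rw [Sym2.eq_swap]
    exact ⟨h.1.symm, h.2⟩
  have hTs' (v w x y : V) (h : T v w x y) : T v w y x := by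
    rw [hT] at h ⊢
    exact ⟨h.1, h.2.symm⟩
  have hEdge {v w x y : V} (h : T v w x y) : ({v, w, x, y} : Set V) ∈ H.edgeSet :=
    (Hypergraph.pairLink_adj_iff.1 ((hT _ _ _ _).1 h).2.adj_sub).2
  refine H.le_ncard_tightPaths (16 * k + 17) (hdistinct habc) (hdistinct hxyz) hdisj hnC ?_
  have hwalks := le_card_connecting_walks hTs hTs' (fun v w hvw => ?_) hζ (habc.le_card hV hζ.le hn2)
    (hxyz.le_card hV hζ.le hn2) hnζ
  · refine le_trans ?_ (le_card_tight_walks_four k a b c x y z _ hκ.le hδ.le hwalks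
      (fun t ht => ?_) (fun t ht => ?_) (fun t ht => ?_) (fun t ht => ?_) (fun t ht => ?_)
      (fun t ht => ?_) (fun t ht => ?_))
    · exact le_rfl
    all_goals
      obtain ⟨⟨hA, hB⟩, ⟨hCv, hCw⟩, hT1, hT2, hT3⟩ := (Finset.mem_filter.1 ht).2
      obtain ⟨hA1, hA2, hA3⟩ := (Finset.mem_filter.1 hA).2
      obtain ⟨hB1, hB2, hB3⟩ := (Finset.mem_filter.1 hB).2
    · exact hA1
    · convert hB1 using 1
      ext; simp; tauto
    · convert hEdge hT1 using 1
      ext; simp; tauto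
    · convert hEdge hT2 using 1
      ext; simp; tauto
    · convert hEdge hT3 using 1
      ext; simp; tauto
    · refine le_trans ?_ (H.le_card_link_tight_walks (η := η) k hα_pos.le hβ.le hη.le hR hnα
        t.1.1 b c t.2.1.1 t.2.1.2 ?_ ?_)
      · exact le_rfl
      · exact (mul_le_mul_of_nonneg_right (min_le_left _ _) (Nat.cast_nonneg _)).trans hA3
      · refine ((mul_le_mul_of_nonneg_right (min_le_right _ _) (Nat.cast_nonneg _)).trans
          hCv).trans (Nat.cast_le.2 (Finset.card_le_card fun u hu => ?_))
        exact Finset.mem_filter.2 ⟨Finset.mem_univ _, (hT _ _ _ _).1 (Finset.mem_filter.1 hu).2⟩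
    -- The second half runs backwards from `z`, so its walk in the link of `w` starts with `y, x`.
    · refine le_trans ?_ (H.le_card_link_tight_walks (η := η) k hα_pos.le hβ.le hη.le hR hnα
        t.1.2 y x t.2.2.1 t.2.2.2 ?_ ?_)
      · exact le_rfl
      · refine ((mul_le_mul_of_nonneg_right (min_le_left _ _) (Nat.cast_nonneg _)).trans
          hB2).trans (Nat.cast_le.2 (Finset.card_le_card fun u hu => ?_))
        have hu := (Finset.mem_filter.1 hu).2
        exact Finset.mem_filter.2 ⟨Finset.mem_univ _, hu.1, hu.2.symm⟩
      · refine ((mul_le_mul_of_nonneg_right (min_le_right _ _) (Nat.cast_nonneg _)).trans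
          hCw).trans (Nat.cast_le.2 (Finset.card_le_card fun u hu => ?_))
        exact Finset.mem_filter.2 ⟨Finset.mem_univ _, (hT _ _ _ _).1 (Finset.mem_filter.1 hu).2⟩
  -- Here `4/9 = 5/9 - 1/9`, because `R_{vw}` misses at most `n / 3` vertices.
  · have h1 := hR s(v, w) (by simpa using hvw)
    have h2 := h1.le_card_adj
    have h3 := h1.card_verts
    rw [Nat.card_eq_fintype_card] at h3
    have h4 : ((R s(v, w)).verts.ncard : ℝ) ≤ Fintype.card V := by
      rw [← Nat.card_eq_fintype_card, ← Set.ncard_univ]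
      exact Nat.cast_le.2 (Set.ncard_le_ncard (Set.subset_univ _))
    have h5 : ((Fintype.card V : ℝ) - (R s(v, w)).verts.ncard) ^ 2 ≤
        ((Fintype.card V : ℝ) / 3) ^ 2 :=
      pow_le_pow_left₀ (by linarith) (by nlinarith) 2
    have h6 : 0 ≤ α * (Fintype.card V : ℝ) ^ 2 := by positivity
    refine le_trans ?_ (h2.trans (Nat.cast_le.2 (Finset.card_le_card fun p hp => ?_)))
    · nlinarith
    · exact Finset.mem_filter.2 ⟨Finset.mem_univ _,
        (hT _ _ _ _).2 ⟨hvw, (Finset.mem_filter.1 hp).2⟩⟩
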